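/- A qubit state is a positive semidefinite matrix $\rho\in\mathbb{C}^{2\times 2}$ with trace $1$. Its Bloch radius is $\|x\|_2$, where $x\in\mathbb{R}^3$ is the Bloch vector determined by $\rho=\frac12(I+x_1\sigma_1+x_2\sigma_2+x_3\sigma_3)$ and $$\sigma_1=\begin{pmatrix}0&1\\1&0\end{pmatrix},\qquad \sigma_2=\begin{pmatrix}0&i\\-i&0\end{pmatrix},\qquad \sigma_3=\begin{pmatrix}1&0\\0&-1\end{pmatrix}.$$ A qubit channel is a completely positive, trace preserving linear map $\Phi:\mathbb{C}^{2\times 2}\to\mathbb{C}^{2\times 2}$. Writing $Q_{ij}=\Phi(E_{ij})$ for the images of the matrix units, a channel has the form $$Q_{11}=\begin{pmatrix}a&b\\ \bar b&1-a\end{pmatrix},\quad Q_{12}=Q_{21}^*=\begin{pmatrix}c&d\\ e&-c\end{pmatrix},\quad Q_{22}=\begin{pmatrix}f&g\\ \bar g&1-f\end{pmatrix}$$ with $a,f\in\mathbb{R}$ and $b,c,d,e,g\in\mathbb{C}$, so the set of all qubit channels is identified with a set $\mathcal{Q}\subset\mathbb{R}^2\times\mathbb{C}^5\cong\mathbb{R}^{12}$.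 A random qubit channel is uniformly distributed if its coordinates $(a,f,b,c,d,e,g)$ are uniformly distributed on $\mathcal{Q}$ with respect to Lebesgue measure. **Theorem.** Let $\rho$ be a qubit state with Bloch radius $r_0\in[0,1]$ and let $\Phi$ be a uniformly distributed random qubit channel. Then the Bloch radius of the output state $\Phi(\rho)$ has a probability density with respect to Lebesgue measure, which is supported on $(0,1]$ and given there by the nonnegative function $$\kappa(r,r_0)=\begin{cases}\dfrac{40r^2}{r_0(1+r_0)^6}\left(21r^4-6r^2r_0^2-36r^2r_0+r_0^4+6r_0^3+12r_0^2+2r_0\right), & 0<r\le r_0,\\[2ex] \dfrac{40r(r-1)^6}{(1-r_0^2)^6}\left(21r_0^4-6r^2r_0^2-36rr_0^2+r^4+6r^3+12r^2+2r\right), & r_0<r\le 1.\end{cases}$$ -/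

import Mathlib

open MeasureTheory ProbabilityTheory
open scoped ComplexOrder MatrixOrder Matrix.Norms.L2Operator CStarAlgebra

/-- Complex `2 × 2` matrices, with the operator norm and the Loewner order. -/
abbrev Mat2 : Type := Matrix (Fin 2) (Fin 2) ℂ

/-- A qubit state: a positive semidefinite matrix of trace one. -/
def IsQubitState (ρ : Mat2) : Prop :=
  ρ.PosSemidef ∧ ρ.trace = 1

/-- The Pauli matrices `σ₁, σ₂, σ₃`
(indexed from zero, with the sign convention `σ₂ = !![0, i; -i, 0]`). -/
noncomputable def pauli : Fin 3 → Mat2 :=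
  ![!![0, 1; 1, 0], !![0, Complex.I; -Complex.I, 0], !![1, 0; 0, -1]]

/-- The Stokes parametrization `x ↦ (I + x · σ) / 2`. -/
noncomputable def stokes (x : EuclideanSpace ℝ (Fin 3)) : Mat2 :=
  (1 / 2 : ℂ) • (1 + ∑ i, (x i : ℂ) • pauli i)

/-- The Bloch vector `xᵢ = Tr (ρ σᵢ)` of a state; it inverts the Stokes parametrization,
see `blochVector_stokes` and `stokes_blochVector`. -/
noncomputable def blochVector (ρ : Mat2) : EuclideanSpace ℝ (Fin 3) :=
  WithLp.toLp 2 fun i => (ρ * pauli i).trace.re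

/-- The Bloch radius: the Euclidean norm of the Bloch vector. -/
noncomputable def blochRadius (ρ : Mat2) : ℝ :=
  ‖blochVector ρ‖

theorem blochVector_stokes (x : EuclideanSpace ℝ (Fin 3)) : blochVector (stokes x) = x := by
  ext i
  fin_cases i <;>
    simp [blochVector, stokes, pauli, Fin.sum_univ_three, Matrix.trace, Matrix.mul_apply,
      Fin.sum_univ_two] <;> ring

theorem stokes_blochVector {ρ : Mat2} (hρ : IsQubitState ρ) : stokes (blochVector ρ) = ρ := by
  obtain ⟨hpos, htr⟩ := hρ
  have h01 := hpos.isHermitian.apply 0 1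
  have h00 := hpos.isHermitian.apply 0 0
  have h11 := hpos.isHermitian.apply 1 1
  simp only [Matrix.trace, Matrix.diag, Fin.sum_univ_two] at htr
  simp only [Complex.ext_iff] at h01 h00 h11 htr
  simp at h01 h00 h11 htr
  ext i j
  fin_cases i <;> fin_cases j <;>
    simp [blochVector, stokes, pauli, Fin.sum_univ_three, Matrix.trace, Matrix.mul_apply,
      Fin.sum_univ_two, Complex.ext_iff] <;> constructor <;> linarith

/-- A qubit channel: a completely positive and trace preserving linear map on `2 × 2` matrices. -/
structure QubitChannel extends Mat2 →CP Mat2 where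
  trace_map' (X : Mat2) : (toFun X).trace = X.trace

namespace QubitChannel

/-- The twelve real coordinates of a qubit channel. In block form its Choi matrix
`(Q₁₁, Q₁₂; Q₂₁, Q₂₂)`, where `Qᵢⱼ` is the image of the matrix unit `Eᵢⱼ`, reads
`Q₁₁ = !![a, b; conj b, 1 - a]`, `Q₁₂ = !![c, d; e, -c]`, `Q₂₁ = Q₁₂ᴴ` and
`Q₂₂ = !![f, g; conj g, 1 - f]`; the coordinates are `(a, f, b, c, d, e, g)`. -/
noncomputable def coords (Φ : QubitChannel) : ℝ × ℝ × ℂ × ℂ × ℂ × ℂ × ℂ :=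
  let Q : Fin 2 → Fin 2 → Mat2 := fun i j => Φ.toLinearMap (Matrix.single i j 1)
  ((Q 0 0 0 0).re, (Q 1 1 0 0).re, Q 0 0 0 1, Q 0 1 0 0, Q 0 1 0 1, Q 0 1 1 0, Q 1 1 0 1)

/-- A qubit channel is determined by its coordinates. -/
theorem coords_injective : Function.Injective coords := by
  intro Φ Ψ h
  have hstar : ∀ (Θ : QubitChannel) (i j : Fin 2), Θ.toLinearMap (Matrix.single j i 1) =
      (Θ.toLinearMap (Matrix.single i j 1)).conjTranspose := by
    intro Θ i j
    have := map_star Θ.toCompletelyPositiveMap (Matrix.single i j 1)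
    rw [Matrix.star_eq_conjTranspose, Matrix.conjTranspose_single, star_one] at this
    exact this
  have htr : ∀ (Θ : QubitChannel) (i j : Fin 2),
      Θ.toLinearMap (Matrix.single i j 1) 0 0 + Θ.toLinearMap (Matrix.single i j 1) 1 1 =
        if i = j then 1 else 0 := by
    intro Θ i j
    have := Θ.trace_map' (Matrix.single i j 1)
    simp only [Matrix.trace, Matrix.diag, Fin.sum_univ_two] at this
    refine Eq.trans this ?_
    fin_cases i <;> fin_cases j <;> simp [Matrix.single]
  have hdiag : ∀ (Θ : QubitChannel) (i k : Fin 2), Θ.toLinearMap (Matrix.single i i 1) k k =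
      ((Θ.toLinearMap (Matrix.single i i 1) k k).re : ℂ) := by
    intro Θ i k
    have := congrFun (congrFun (hstar Θ i i) k) k
    rw [Matrix.conjTranspose_apply] at this
    exact (Complex.conj_eq_iff_real.mp this.symm).elim fun r hr => by rw [hr]; simp
  simp only [coords, Prod.mk.injEq] at h
  obtain ⟨ha, hf, hb, hc, hd, he, hg⟩ := h
  have key : ∀ i j : Fin 2,
      Φ.toLinearMap (Matrix.single i j 1) = Ψ.toLinearMap (Matrix.single i j 1) := by
    have ha' : Φ.toLinearMap (Matrix.single 0 0 1) 0 0 = Ψ.toLinearMap (Matrix.single 0 0 1) 0 0 := by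
      rw [hdiag Φ 0 0, hdiag Ψ 0 0, ha]
    have hf' : Φ.toLinearMap (Matrix.single 1 1 1) 0 0 = Ψ.toLinearMap (Matrix.single 1 1 1) 0 0 := by
      rw [hdiag Φ 1 0, hdiag Ψ 1 0, hf]
    have h11 : ∀ i j : Fin 2,
        Φ.toLinearMap (Matrix.single i j 1) 0 0 = Ψ.toLinearMap (Matrix.single i j 1) 0 0 →
        Φ.toLinearMap (Matrix.single i j 1) 1 1 = Ψ.toLinearMap (Matrix.single i j 1) 1 1 := by
      intro i j hij
      have h1 := htr Φ i j
      rw [hij, ← htr Ψ i j] at h1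
      exact add_left_cancel h1
    have h10 : ∀ i : Fin 2,
        Φ.toLinearMap (Matrix.single i i 1) 0 1 = Ψ.toLinearMap (Matrix.single i i 1) 0 1 →
        Φ.toLinearMap (Matrix.single i i 1) 1 0 = Ψ.toLinearMap (Matrix.single i i 1) 1 0 := by
      intro i hi
      rw [hstar Φ i i, hstar Ψ i i, Matrix.conjTranspose_apply, Matrix.conjTranspose_apply, hi]
    have h01 : Φ.toLinearMap (Matrix.single 0 1 1) = Ψ.toLinearMap (Matrix.single 0 1 1) := by
      ext k l
      fin_cases k <;> fin_cases l
      exacts [hc, hd, he, h11 0 1 hc]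
    intro i j
    fin_cases i <;> fin_cases j
    · ext k l
      fin_cases k <;> fin_cases l
      exacts [ha', hb, h10 0 hb, h11 0 0 ha']
    · exact h01
    · exact (hstar Φ 0 1).trans (h01 ▸ (hstar Ψ 0 1).symm)
    · ext k l
      fin_cases k <;> fin_cases l
      exacts [hf', hg, h10 1 hg, h11 1 1 hf']
  have hlin : Φ.toLinearMap = Ψ.toLinearMap := by
    refine Matrix.ext_linearMap ℂ fun i j => ?_
    ext1
    exact key i j
  obtain ⟨⟨f, hf1⟩, hf2⟩ := Φ
  obtain ⟨⟨g, hg1⟩, hg2⟩ := Ψ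
  cases hlin
  rfl

/-- A random qubit channel `Φ` is uniformly distributed if its coordinates are uniformly
distributed, with respect to Lebesgue measure, on the set of the coordinates of all qubit
channels. -/
def IsUniform {Ω : Type*} [MeasurableSpace Ω] (Φ : Ω → QubitChannel) (P : Measure Ω) : Prop :=
  pdf.IsUniform (fun ω => (Φ ω).coords) (Set.range coords) P volume

end QubitChannel

/-- The density `κ(r, r₀)` of the output radius `r ∈ (0, 1]` at the input radius `r₀`. -/
noncomputable def kappa (r r₀ : ℝ) : ℝ :=
  if r ≤ r₀ then
    40 * r ^ 2 / (r₀ * (1 + r₀) ^ 6) *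
      (21 * r ^ 4 - 6 * r ^ 2 * r₀ ^ 2 - 36 * r ^ 2 * r₀
        + r₀ ^ 4 + 6 * r₀ ^ 3 + 12 * r₀ ^ 2 + 2 * r₀)
  else
    40 * r * (r - 1) ^ 6 / (1 - r₀ ^ 2) ^ 6 *
      (21 * r₀ ^ 4 - 6 * r ^ 2 * r₀ ^ 2 - 36 * r * r₀ ^ 2
        + r ^ 4 + 6 * r ^ 3 + 12 * r ^ 2 + 2 * r)

/-! By the Choi–Kraus theorem a trace preserving map is a channel exactly when its `4 × 4` Choi
matrix is positive semidefinite (`QubitChannel.mem_range_coords_iff`). Composing with unitary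
conjugations before and after the channel acts on coordinates by affine bijections that map the set
of channels onto itself. Since that set has positive finite volume, the action preserves Lebesgue
measure on it (`measurePreserving_conjCoords`). So the law of the output Bloch vector is rotation
invariant, depends on `ρ` only through `r₀`, and each of its marginals is the law of one number `z`,
the third Bloch coordinate of the image of `diag((1 + r₀)/2, (1 - r₀)/2)`.

The law of `z` is found by integrating out the other coordinates. With the output index first, the
Choi matrix is `[A, X; Xᴴ, 1 - A]`. For `0 < A < 1` the admissible `X` are `L Y Kᴴ` with `A = L Lᴴ`,
`1 - A = K Kᴴ` and `Y` a contraction, so they fill a volume proportional to `det(A)² det(1 - A)²`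
(`volume_offDiagonal_blocks`). If `A` has diagonal `(1 + s ± w)/2` and off-diagonal entry `c`, then
`z = s + r₀ w`. Integrating over `c` leaves `profile |s| w`, and integrating this polynomial along
the line `z = s + r₀ w` inside the square `|s| + |w| < 1` gives `outputDensity r₀ z`.

A radial density `g(‖v‖)` on `ℝ³` has radius density proportional to `r² g(r)` and, as in
Archimedes' theorem on the sphere, marginal proportional to `∫_{|z|}^∞ r g(r) dr`. For `g = κ/r²`
everything thus reduces to `∫_{|z|}^1 κ(r, r₀)/r dr` being proportional to `outputDensity r₀ z`,
which is checked by explicit primitives on either side of `r₀`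
(`lintegral_kappa_div_eq_outputDensity`). One marginal determines the characteristic function of a
radial measure (`charFun_withDensity_comp_norm`), so the two laws on `ℝ³` are proportional.
Multiplicative constants need no evaluation: the last one is fixed by `κ` having total mass one
(`lintegral_kappa`). -/

/-- A positive semidefinite complex matrix factors as `B * Bᴴ`. -/
theorem Matrix.PosSemidef.exists_eq_mul_conjTranspose {n : Type*} [Fintype n] [DecidableEq n]
    {M : Matrix n n ℂ} (hM : M.PosSemidef) : ∃ B : Matrix n n ℂ, M = B * B.conjTranspose :=
  CStarAlgebra.nonneg_iff_eq_mul_star_self.mp (Matrix.nonneg_iff_posSemidef.mpr hM)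

/-! ### Choi matrices and Kraus operators -/

/-- The Choi matrix of a linear map on `2 × 2` matrices; the output index comes first. -/
def choiMatrix (Ψ : Mat2 →ₗ[ℂ] Mat2) : Matrix (Fin 2 × Fin 2) (Fin 2 × Fin 2) ℂ :=
  Matrix.of fun p q => Ψ (Matrix.single p.2 q.2 1) p.1 q.1

theorem apply_eq_sum_single (Ψ : Mat2 →ₗ[ℂ] Mat2) (X : Mat2) :
    Ψ X = ∑ i, ∑ j, X i j • Ψ (Matrix.single i j 1) := by
  conv_lhs => rw [Matrix.matrix_eq_sum_single X]
  simp only [map_sum]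
  refine Finset.sum_congr rfl fun i _ => Finset.sum_congr rfl fun j _ => ?_
  rw [← map_smul, Matrix.smul_single, smul_eq_mul, mul_one]

theorem CompletelyPositiveMap.posSemidef_choiMatrix (Φ : Mat2 →CP Mat2) :
    (choiMatrix Φ.toLinearMap).PosSemidef := by
  -- One row `(E₀₀, E₀₁)` padded by zeros: since `Eᵢ₀ E₀ⱼ = Eᵢⱼ`, the product `star N * N` is the
  -- matrix of all matrix units, and its image under `Φ` is the Choi matrix up to reindexing.
  let N : CStarMatrix (Fin 2) (Fin 2) Mat2 :=
    CStarMatrix.ofMatrix (Matrix.of fun i j => if i = 0 then Matrix.single 0 j 1 else 0)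
  have hN : 0 ≤ (star N * N) := star_mul_self_nonneg N
  have hNij : ∀ i j, (star N * N) i j = Matrix.single i j (1 : ℂ) := by
    intro i j
    rw [CStarMatrix.mul_apply, Fin.sum_univ_two, CStarMatrix.star_apply, CStarMatrix.star_apply]
    simp [N, Matrix.star_eq_conjTranspose]
  have h := Φ.map_cstarMatrix_nonneg' 2 _ hN
  have hpos : ∀ M : CStarMatrix (Fin 2) (Fin 2) Mat2, 0 ≤ M →
      (Matrix.of fun p q : Fin 2 × Fin 2 => M p.2 q.2 p.1 q.1 : Matrix _ _ ℂ).PosSemidef := by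
    intro M hM
    rw [StarOrderedRing.nonneg_iff] at hM
    induction hM using AddSubmonoid.closure_induction with
    | mem M hM =>
      obtain ⟨Y, rfl⟩ := hM
      let Z : Matrix (Fin 2 × Fin 2) (Fin 2 × Fin 2) ℂ := Matrix.of fun m q => Y m.1 q.2 m.2 q.1
      convert Matrix.posSemidef_conjTranspose_mul_self Z
      ext p q
      simp only [Matrix.of_apply, CStarMatrix.mul_apply, CStarMatrix.star_apply]
      simp [Z, Matrix.mul_apply, Fintype.sum_prod_type, Fin.sum_univ_two,
        Matrix.star_eq_conjTranspose]
    | zero => exact Matrix.PosSemidef.zero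
    | add M N _ _ hM hN => exact hM.add hN
  convert hpos _ h using 1
  ext p q
  simp only [choiMatrix, Matrix.of_apply, CStarMatrix.map_apply, hNij]

/-- In a factorization `B * Bᴴ` of the Choi matrix, each column of `B`, reshaped to a `2 × 2`
matrix, is a Kraus operator. -/
theorem exists_kraus_of_posSemidef_choiMatrix {Ψ : Mat2 →ₗ[ℂ] Mat2}
    (h : (choiMatrix Ψ).PosSemidef) :
    ∃ V : Fin 2 × Fin 2 → Mat2, ∀ X, Ψ X = ∑ a, V a * X * (V a).conjTranspose := by
  obtain ⟨B, hB⟩ := h.exists_eq_mul_conjTranspose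
  refine ⟨fun a => Matrix.of fun k i => B (k, i) a, fun X => ?_⟩
  have hΨ : ∀ i j k l, Ψ (Matrix.single i j 1) k l = ∑ a, B (k, i) a * star (B (l, j) a) := by
    intro i j k l
    have := congrFun (congrFun hB (k, i)) (l, j)
    simpa [choiMatrix, Matrix.mul_apply] using this
  rw [apply_eq_sum_single]
  ext k l
  simp only [Fin.sum_univ_two, Matrix.add_apply, Matrix.sum_apply, Matrix.smul_apply, hΨ, Matrix.mul_apply, Matrix.of_apply,
    Matrix.conjTranspose_apply, Fin.sum_univ_two, Fintype.sum_prod_type, smul_eq_mul]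
  ring

/-- A linear map in Kraus form that preserves the trace is a qubit channel. -/
theorem QubitChannel.exists_of_kraus {ι : Type*} [Fintype ι] {Ψ : Mat2 →ₗ[ℂ] Mat2} (V : ι → Mat2)
    (hV : ∀ X, Ψ X = ∑ a, V a * X * (V a).conjTranspose) (htr : ∀ X, (Ψ X).trace = X.trace) :
    ∃ Φ : QubitChannel, Φ.toLinearMap = Ψ := by
  refine ⟨⟨⟨Ψ, fun k M hM => ?_⟩, htr⟩, rfl⟩
  -- Applying the map entrywise is a sum of conjugations by the block diagonal `W a`, and
  -- conjugation preserves positivity.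
  let W : ι → CStarMatrix (Fin k) (Fin k) Mat2 := fun a =>
    CStarMatrix.ofMatrix (Matrix.diagonal fun _ => V a)
  have : M.map Ψ = ∑ a, W a * M * star (W a) := by
    ext1 i j
    have hs : (∑ a, W a * M * star (W a)) i j = ∑ a, (W a * M * star (W a)) i j :=
      Matrix.sum_apply i j _ _
    rw [CStarMatrix.map_apply, hV, hs]
    refine Finset.sum_congr rfl fun a _ => ?_
    simp only [CStarMatrix.mul_apply, CStarMatrix.star_apply, W, CStarMatrix.ofMatrix_apply,
      Matrix.diagonal_apply]
    rw [Finset.sum_eq_single j]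
    · rw [Finset.sum_eq_single i]
      · simp [Matrix.star_eq_conjTranspose]
      · intro b _ hb; simp [Ne.symm hb]
      · simp
    · intro b _ hb; simp [Ne.symm hb]
    · simp
  rw [this]
  exact Finset.sum_nonneg fun a _ => star_right_conjugate_nonneg hM _

/-! ### The set of channels in coordinates -/

/-- The real coordinates of a linear map on `2 × 2` matrices, as a linear function of the map. -/
noncomputable def coordsLin : (Mat2 →ₗ[ℂ] Mat2) →ₗ[ℝ] ℝ × ℝ × ℂ × ℂ × ℂ × ℂ × ℂ where
  toFun Ψ := ((Ψ (Matrix.single 0 0 1) 0 0).re, (Ψ (Matrix.single 1 1 1) 0 0).re,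
    Ψ (Matrix.single 0 0 1) 0 1, Ψ (Matrix.single 0 1 1) 0 0, Ψ (Matrix.single 0 1 1) 0 1,
    Ψ (Matrix.single 0 1 1) 1 0, Ψ (Matrix.single 1 1 1) 0 1)
  map_add' Ψ Θ := by simp
  map_smul' r Ψ := by simp

theorem coordsLin_apply (Ψ : Mat2 →ₗ[ℂ] Mat2) :
    coordsLin Ψ = ((Ψ (Matrix.single 0 0 1) 0 0).re, (Ψ (Matrix.single 1 1 1) 0 0).re,
      Ψ (Matrix.single 0 0 1) 0 1, Ψ (Matrix.single 0 1 1) 0 0, Ψ (Matrix.single 0 1 1) 0 1,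
      Ψ (Matrix.single 0 1 1) 1 0, Ψ (Matrix.single 1 1 1) 0 1) := rfl

theorem QubitChannel.coords_eq_coordsLin (Φ : QubitChannel) :
    Φ.coords = coordsLin Φ.toLinearMap := rfl

/-- The Hermiticity and trace preserving linear map with the given coordinates. -/
noncomputable def linOf (x : ℝ × ℝ × ℂ × ℂ × ℂ × ℂ × ℂ) : Mat2 →ₗ[ℂ] Mat2 where
  toFun X := X 0 0 • !![(x.1 : ℂ), x.2.2.1; star x.2.2.1, 1 - x.1] +
    X 0 1 • !![x.2.2.2.1, x.2.2.2.2.1; x.2.2.2.2.2.1, -x.2.2.2.1] +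
    X 1 0 • !![star x.2.2.2.1, star x.2.2.2.2.2.1; star x.2.2.2.2.1, -star x.2.2.2.1] +
    X 1 1 • !![(x.2.1 : ℂ), x.2.2.2.2.2.2; star x.2.2.2.2.2.2, 1 - x.2.1]
  map_add' X Y := by simp only [Matrix.add_apply, add_smul]; abel
  map_smul' r X := by simp only [Matrix.smul_apply, smul_eq_mul, mul_smul, RingHom.id_apply, smul_add]

theorem coordsLin_linOf (x : ℝ × ℝ × ℂ × ℂ × ℂ × ℂ × ℂ) : coordsLin (linOf x) = x := by
  obtain ⟨a, f, b, c, d, e, g⟩ := x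
  simp [coordsLin_apply, linOf]

/-- Hermiticity determines the image of `E₁₀` and the lower left entries of the diagonal images; the
trace condition determines every lower right entry. Only the twelve coordinates remain free. -/
theorem linOf_coordsLin {Ψ : Mat2 →ₗ[ℂ] Mat2}
    (hstar : ∀ X, Ψ X.conjTranspose = (Ψ X).conjTranspose)
    (htr : ∀ X, (Ψ X).trace = X.trace) : linOf (coordsLin Ψ) = Ψ := by
  have h1 : ∀ i j k l, Ψ (Matrix.single j i 1) k l = star (Ψ (Matrix.single i j 1) l k) := by
    intro i j k l
    have := hstar (Matrix.single i j 1)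
    rw [Matrix.conjTranspose_single, star_one] at this
    rw [this, Matrix.conjTranspose_apply]
  have h2 : ∀ i j, Ψ (Matrix.single i j 1) 1 1 =
      (if i = j then 1 else 0) - Ψ (Matrix.single i j 1) 0 0 := by
    intro i j
    have := htr (Matrix.single i j 1)
    simp only [Matrix.trace, Matrix.diag, Fin.sum_univ_two] at this
    rw [eq_sub_iff_add_eq', this]
    fin_cases i <;> fin_cases j <;> simp [Matrix.single]
  have h3 : ∀ i, Ψ (Matrix.single i i 1) 0 0 = ((Ψ (Matrix.single i i 1) 0 0).re : ℂ) := by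
    intro i
    have := h1 i i 0 0
    exact (Complex.conj_eq_iff_real.mp this.symm).elim fun r hr => by rw [hr]; simp
  refine Matrix.ext_linearMap ℂ fun i j => ?_
  ext1
  ext k l
  fin_cases i <;> fin_cases j <;> fin_cases k <;> fin_cases l <;>
    simp [coordsLin_apply, linOf, ← h3, h2, h1 0 1, ← h1 0 0, ← h1 1 1]

theorem linOf_conjTranspose (x : ℝ × ℝ × ℂ × ℂ × ℂ × ℂ × ℂ) (X : Mat2) :
    linOf x X.conjTranspose = (linOf x X).conjTranspose := by
  ext k l
  fin_cases k <;> fin_cases l <;> simp [linOf] <;> ring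

theorem trace_linOf (x : ℝ × ℝ × ℂ × ℂ × ℂ × ℂ × ℂ) (X : Mat2) :
    (linOf x X).trace = X.trace := by
  simp [linOf, Matrix.trace, Fin.sum_univ_two]
  ring

theorem QubitChannel.linOf_coords (Φ : QubitChannel) : linOf Φ.coords = Φ.toLinearMap :=
  linOf_coordsLin (fun X => map_star Φ.toCompletelyPositiveMap X) Φ.trace_map'

/-- This replaces complete positivity by a condition on a `4 × 4` matrix; it is what makes the
volume computable. -/
theorem QubitChannel.mem_range_coords_iff (x : ℝ × ℝ × ℂ × ℂ × ℂ × ℂ × ℂ) :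
    x ∈ Set.range QubitChannel.coords ↔ (choiMatrix (linOf x)).PosSemidef := by
  constructor
  · rintro ⟨Φ, rfl⟩
    rw [Φ.linOf_coords]
    exact Φ.toCompletelyPositiveMap.posSemidef_choiMatrix
  · intro h
    obtain ⟨V, hV⟩ := exists_kraus_of_posSemidef_choiMatrix h
    obtain ⟨Φ, hΦ⟩ := QubitChannel.exists_of_kraus V hV (trace_linOf x)
    exact ⟨Φ, by rw [Φ.coords_eq_coordsLin, hΦ, coordsLin_linOf]⟩

/-! ### Unitary symmetries of the set of channels -/

/-- Conjugation of a linear map on `2 × 2` matrices by `U` before and by `W` after the map. -/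
def conjMap (U W : Mat2) (Ψ : Mat2 →ₗ[ℂ] Mat2) : Mat2 →ₗ[ℂ] Mat2 where
  toFun X := W * Ψ (U * X * U.conjTranspose) * W.conjTranspose
  map_add' X Y := by simp only [mul_add, add_mul, map_add]
  map_smul' r X := by
    simp only [Matrix.mul_smul, Matrix.smul_mul, map_smul, RingHom.id_apply]

theorem conjMap_apply (U W : Mat2) (Ψ : Mat2 →ₗ[ℂ] Mat2) (X : Mat2) :
    conjMap U W Ψ X = W * Ψ (U * X * U.conjTranspose) * W.conjTranspose := rfl

/-- The action of a pair of unitaries on the coordinates of channels. -/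
noncomputable def conjCoords (U W : Mat2) (x : ℝ × ℝ × ℂ × ℂ × ℂ × ℂ × ℂ) :
    ℝ × ℝ × ℂ × ℂ × ℂ × ℂ × ℂ :=
  coordsLin (conjMap U W (linOf x))

theorem trace_unitary_conj {U : Mat2} (hU : U ∈ Matrix.unitaryGroup (Fin 2) ℂ) (X : Mat2) :
    (U * X * U.conjTranspose).trace = X.trace := by
  rw [Matrix.trace_mul_comm, ← mul_assoc]
  have : U.conjTranspose * U = 1 := Matrix.mem_unitaryGroup_iff'.mp hU
  rw [this, one_mul]

theorem linOf_conjCoords {U W : Mat2} (hU : U ∈ Matrix.unitaryGroup (Fin 2) ℂ)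
    (hW : W ∈ Matrix.unitaryGroup (Fin 2) ℂ) (x : ℝ × ℝ × ℂ × ℂ × ℂ × ℂ × ℂ) :
    linOf (conjCoords U W x) = conjMap U W (linOf x) := by
  refine linOf_coordsLin (fun X => ?_) (fun X => ?_)
  · simp only [conjMap_apply, Matrix.conjTranspose_mul, Matrix.conjTranspose_conjTranspose,
      ← linOf_conjTranspose, mul_assoc]
  · rw [conjMap_apply, trace_unitary_conj hW, trace_linOf, trace_unitary_conj hU]

theorem conjCoords_conjCoords {U W : Mat2} (hU : U ∈ Matrix.unitaryGroup (Fin 2) ℂ)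
    (hW : W ∈ Matrix.unitaryGroup (Fin 2) ℂ) (x : ℝ × ℝ × ℂ × ℂ × ℂ × ℂ × ℂ) :
    conjCoords U.conjTranspose W.conjTranspose (conjCoords U W x) = x := by
  rw [conjCoords, linOf_conjCoords hU hW]
  conv_rhs => rw [← coordsLin_linOf x]
  congr 1
  have hU' : U * U.conjTranspose = 1 := Matrix.mem_unitaryGroup_iff.mp hU
  have hW' : W.conjTranspose * W = 1 := Matrix.mem_unitaryGroup_iff'.mp hW
  ext1 X
  simp only [conjMap_apply, Matrix.conjTranspose_conjTranspose]
  have h1 : U * (U.conjTranspose * X * U) * U.conjTranspose = X := by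
    calc _ = (U * U.conjTranspose) * X * (U * U.conjTranspose) := by simp only [mul_assoc]
      _ = X := by rw [hU', one_mul, mul_one]
  rw [h1]
  calc _ = (W.conjTranspose * W) * (linOf x X) * (W.conjTranspose * W) := by simp only [mul_assoc]
      _ = _ := by rw [hW', one_mul, mul_one]

theorem conjCoords_mem_range_coords {U W : Mat2} (hU : U ∈ Matrix.unitaryGroup (Fin 2) ℂ)
    (hW : W ∈ Matrix.unitaryGroup (Fin 2) ℂ) {x : ℝ × ℝ × ℂ × ℂ × ℂ × ℂ × ℂ}
    (hx : x ∈ Set.range QubitChannel.coords) :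
    conjCoords U W x ∈ Set.range QubitChannel.coords := by
  rw [QubitChannel.mem_range_coords_iff] at hx
  obtain ⟨V, hV⟩ := exists_kraus_of_posSemidef_choiMatrix hx
  obtain ⟨Φ, hΦ⟩ := QubitChannel.exists_of_kraus (Ψ := linOf (conjCoords U W x))
    (fun a => W * V a * U) (fun X => by
      rw [linOf_conjCoords hU hW, conjMap_apply, hV, Finset.mul_sum, Finset.sum_mul]
      refine Finset.sum_congr rfl fun a _ => ?_
      simp only [Matrix.conjTranspose_mul, mul_assoc]) (trace_linOf _)
  exact ⟨Φ, by rw [Φ.coords_eq_coordsLin, hΦ, coordsLin_linOf]⟩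

theorem preimage_conjCoords_range_coords {U W : Mat2} (hU : U ∈ Matrix.unitaryGroup (Fin 2) ℂ)
    (hW : W ∈ Matrix.unitaryGroup (Fin 2) ℂ) :
    conjCoords U W ⁻¹' Set.range QubitChannel.coords = Set.range QubitChannel.coords := by
  ext x
  refine ⟨fun hx => ?_, fun hx => conjCoords_mem_range_coords hU hW hx⟩
  rw [← conjCoords_conjCoords hU hW x]
  exact conjCoords_mem_range_coords (Unitary.star_mem hU) (Unitary.star_mem hW) hx

/-- The linear part of `conjCoords`. -/
noncomputable def conjCoordsLin (U W : Mat2) :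
    (ℝ × ℝ × ℂ × ℂ × ℂ × ℂ × ℂ) →ₗ[ℝ] (ℝ × ℝ × ℂ × ℂ × ℂ × ℂ × ℂ) where
  toFun x := conjCoords U W x - conjCoords U W 0
  map_add' x y := by
    have h : conjMap U W (linOf (x + y)) + conjMap U W (linOf 0) =
        conjMap U W (linOf x) + conjMap U W (linOf y) := by
      have : ∀ X, linOf (x + y) X + linOf 0 X = linOf x X + linOf y X := by
        intro X
        ext k l
        fin_cases k <;> fin_cases l <;> simp [linOf] <;> ring
      ext1 X
      simp only [LinearMap.add_apply, conjMap_apply, ← add_mul, ← mul_add, this]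
    have := congrArg coordsLin h
    rw [map_add, map_add] at this
    simp only [conjCoords]
    rw [eq_sub_of_add_eq this]
    abel
  map_smul' r x := by
    have h : conjMap U W (linOf (r • x)) - conjMap U W (linOf 0) =
        r • (conjMap U W (linOf x) - conjMap U W (linOf 0)) := by
      have : ∀ X, linOf (r • x) X - linOf 0 X = r • (linOf x X - linOf 0 X) := by
        intro X
        ext k l
        fin_cases k <;> fin_cases l <;> simp [linOf] <;> ring
      ext1 X
      simp only [LinearMap.sub_apply, LinearMap.smul_apply, conjMap_apply, ← sub_mul, ← mul_sub,
        this, Matrix.mul_smul, Matrix.smul_mul]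
    have := congrArg coordsLin h
    rwa [map_smul, map_sub, map_sub] at this

theorem conjCoords_eq (U W : Mat2) (x : ℝ × ℝ × ℂ × ℂ × ℂ × ℂ × ℂ) :
    conjCoords U W x = conjCoordsLin U W x + conjCoords U W 0 :=
  (sub_add_cancel _ _).symm

/-! ### Haar measure under affine maps -/

/-- A bijective affine self-map that preserves a set of positive and finite Haar measure preserves
the restriction of Haar measure to this set. -/
theorem measurePreserving_restrict_of_affine {E : Type*} [NormedAddCommGroup E] [NormedSpace ℝ E]
    [FiniteDimensional ℝ E] [MeasurableSpace E] [BorelSpace E] (μ : Measure E)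
    [μ.IsAddHaarMeasure] {T : E → E} (L : E →ₗ[ℝ] E) (t : E) (hT : ∀ x, T x = L x + t)
    (hbij : Function.Bijective T) {Q : Set E} (hQm : MeasurableSet Q) (hQ : T ⁻¹' Q = Q)
    (h0 : μ Q ≠ 0) (hfin : μ Q ≠ ⊤) :
    MeasurePreserving T (μ.restrict Q) (μ.restrict Q) := by
  have hLsurj : Function.Surjective L := by
    intro y
    obtain ⟨x, hx⟩ := hbij.2 (y + t)
    exact ⟨x, by rw [hT] at hx; exact add_right_cancel hx⟩
  obtain ⟨c, hc, hmap⟩ := L.exists_map_addHaar_eq_smul_addHaar μ μ hLsurj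
  have hLm : Measurable L := L.continuous_of_finiteDimensional.measurable
  have hTfun : T = (fun x => x + t) ∘ L := funext hT
  have hTm : Measurable T := by
    rw [hTfun]
    exact (measurable_add_const t).comp hLm
  have hTmap : μ.map T = c • μ := by
    rw [hTfun, ← Measure.map_map (measurable_add_const t) hLm, hmap, Measure.map_smul,
      map_add_right_eq_self]
  -- `T` scales all volumes by one factor, and `Q` is its own preimage with volume neither `0` nor
  -- `∞`.
  have hc1 : c = 1 := by
    have h1 : μ.map T Q = μ Q := by rw [Measure.map_apply hTm hQm, hQ]
    rw [hTmap, Measure.smul_apply, smul_eq_mul] at h1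
    exact (ENNReal.mul_eq_right h0 hfin).mp h1
  have hpres : MeasurePreserving T μ μ := ⟨hTm, by rw [hTmap, hc1, one_smul]⟩
  have := hpres.restrict_preimage hQm
  rwa [hQ] at this

/-- A bijective affine map scales Haar measure by a positive finite constant. -/
theorem exists_map_affine_eq_smul {E F : Type*} [NormedAddCommGroup E] [NormedSpace ℝ E]
    [FiniteDimensional ℝ E] [MeasurableSpace E] [BorelSpace E] [NormedAddCommGroup F]
    [NormedSpace ℝ F] [FiniteDimensional ℝ F] [MeasurableSpace F] [BorelSpace F] (μ : Measure E)
    [μ.IsAddHaarMeasure] (ν : Measure F) [ν.IsAddHaarMeasure] (L : E ≃ₗ[ℝ] F) (t : F) :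
    ∃ c : ENNReal, c ≠ 0 ∧ c ≠ ⊤ ∧ μ.map (fun x => L x + t) = c • ν := by
  have hLm : Measurable L := L.toLinearMap.continuous_of_finiteDimensional.measurable
  have := L.toContinuousLinearEquiv.isAddHaarMeasure_map μ
  refine ⟨Measure.addHaarScalarFactor (μ.map L) ν, ?_, ENNReal.coe_ne_top, ?_⟩
  · simpa only [ne_eq, ENNReal.coe_eq_zero] using
      (Measure.addHaarScalarFactor_pos_of_isAddHaarMeasure (μ.map L) ν).ne'
  · have h : (fun x => L x + t) = (fun x => x + t) ∘ L := rfl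
    have h2 : μ.map L = Measure.addHaarScalarFactor (μ.map L) ν • ν :=
      Measure.isAddLeftInvariant_eq_smul (μ.map L) ν
    generalize Measure.addHaarScalarFactor (μ.map L) ν = c at h2
    rw [h, ← Measure.map_map (measurable_add_const t) hLm, h2, Measure.map_smul,
      map_add_right_eq_self]
    rfl

theorem continuous_linOf_apply (X : Mat2) : Continuous fun x => linOf x X := by
  simp only [linOf, LinearMap.coe_mk, AddHom.coe_mk]
  fun_prop

theorem isClosed_posSemidef {n : Type*} [Fintype n] [DecidableEq n] :
    IsClosed {M : Matrix n n ℂ | M.PosSemidef} := by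
  have := CStarAlgebra.isClosed_nonneg (A := Matrix n n ℂ)
  simpa only [Matrix.nonneg_iff_posSemidef] using this

instance isAddHaarMeasure_volume_prod {E F : Type*} [NormedAddCommGroup E] [MeasureSpace E]
    [BorelSpace E] [SecondCountableTopology E] [NormedAddCommGroup F] [MeasureSpace F]
    [BorelSpace F] [SecondCountableTopology F] [SFinite (volume : Measure E)]
    [SFinite (volume : Measure F)] [(volume : Measure E).IsAddHaarMeasure]
    [(volume : Measure F).IsAddHaarMeasure] : (volume : Measure (E × F)).IsAddHaarMeasure :=
  inferInstanceAs ((volume : Measure E).prod volume).IsAddHaarMeasure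

instance : BorelSpace (ℂ × ℂ × ℂ × ℂ × ℂ) := Prod.borelSpace

instance : BorelSpace (ℝ × ℂ × ℂ × ℂ × ℂ × ℂ) := Prod.borelSpace

instance : BorelSpace (ℝ × ℝ × ℂ × ℂ × ℂ × ℂ × ℂ) := Prod.borelSpace

instance : (volume : Measure (ℂ × ℂ × ℂ)).IsAddHaarMeasure :=
  isAddHaarMeasure_volume_prod

instance : (volume : Measure (ℂ × ℂ × ℂ × ℂ)).IsAddHaarMeasure :=
  isAddHaarMeasure_volume_prod

instance : (volume : Measure (ℂ × ℂ × ℂ × ℂ × ℂ)).IsAddHaarMeasure :=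
  isAddHaarMeasure_volume_prod

instance : (volume : Measure (ℝ × ℂ × ℂ × ℂ × ℂ × ℂ)).IsAddHaarMeasure :=
  isAddHaarMeasure_volume_prod

instance : (volume : Measure (ℝ × ℝ × ℂ × ℂ × ℂ × ℂ × ℂ)).IsAddHaarMeasure :=
  isAddHaarMeasure_volume_prod

instance : BorelSpace (ℝ × ℂ × (Fin 2 × Fin 2 → ℂ)) := Prod.borelSpace

instance : BorelSpace (ℝ × ℝ × ℂ × (Fin 2 × Fin 2 → ℂ)) := Prod.borelSpace

instance : (volume : Measure (ℂ × (Fin 2 × Fin 2 → ℂ))).IsAddHaarMeasure :=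
  isAddHaarMeasure_volume_prod

instance : (volume : Measure (ℝ × ℂ × (Fin 2 × Fin 2 → ℂ))).IsAddHaarMeasure :=
  isAddHaarMeasure_volume_prod

instance : (volume : Measure (ℝ × ℝ × ℂ × (Fin 2 × Fin 2 → ℂ))).IsAddHaarMeasure :=
  isAddHaarMeasure_volume_prod

theorem QubitChannel.isClosed_range_coords : IsClosed (Set.range QubitChannel.coords) := by
  have : Set.range QubitChannel.coords =
      (fun x => choiMatrix (linOf x)) ⁻¹' {M | M.PosSemidef} :=
    Set.ext fun x => QubitChannel.mem_range_coords_iff x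
  rw [this]
  refine isClosed_posSemidef.preimage (continuous_matrix fun p q => ?_)
  exact (continuous_linOf_apply _).matrix_elem p.1 q.1

theorem measurePreserving_conjCoords {U W : Mat2} (hU : U ∈ Matrix.unitaryGroup (Fin 2) ℂ)
    (hW : W ∈ Matrix.unitaryGroup (Fin 2) ℂ)
    (h0 : volume (Set.range QubitChannel.coords) ≠ 0)
    (hfin : volume (Set.range QubitChannel.coords) ≠ ⊤) :
    MeasurePreserving (conjCoords U W) (volume.restrict (Set.range QubitChannel.coords))
      (volume.restrict (Set.range QubitChannel.coords)) := by
  refine measurePreserving_restrict_of_affine volume (conjCoordsLin U W) (conjCoords U W 0)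
    (conjCoords_eq U W) ?_ QubitChannel.isClosed_range_coords.measurableSet
    (preimage_conjCoords_range_coords hU hW) h0 hfin
  refine Function.bijective_iff_has_inverse.mpr
    ⟨conjCoords U.conjTranspose W.conjTranspose, conjCoords_conjCoords hU hW, fun x => ?_⟩
  have := conjCoords_conjCoords (Unitary.star_mem hU) (Unitary.star_mem hW) x
  simpa [Matrix.star_eq_conjTranspose] using this

/-! ### Diagonalization of Pauli vectors -/

theorem Matrix.conjTranspose_fin_two (a b c d : ℂ) :
    !![a, b; c, d].conjTranspose = !![star a, star c; star b, star d] := by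
  ext i j
  fin_cases i <;> fin_cases j <;> simp

/-- Pauli vectors are unitarily equivalent to multiples of `σ₃`. -/
theorem exists_unitary_sum_smul_pauli (x : EuclideanSpace ℝ (Fin 3)) :
    ∃ U ∈ Matrix.unitaryGroup (Fin 2) ℂ,
      ∑ i, (x i : ℂ) • pauli i = (‖x‖ : ℂ) • (U * pauli 2 * U.conjTranspose) := by
  have hsum : ∑ i, (x i : ℂ) • pauli i =
      !![(x 2 : ℂ), x 0 + x 1 * Complex.I; x 0 - x 1 * Complex.I, -x 2] := by
    ext i j
    fin_cases i <;> fin_cases j <;> simp [pauli, Fin.sum_univ_three, sub_eq_add_neg]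
  have hn : ‖x‖ ^ 2 = x 0 ^ 2 + x 1 ^ 2 + x 2 ^ 2 := by
    rw [EuclideanSpace.norm_sq_eq, Fin.sum_univ_three]
    simp
  rw [hsum]
  set n := ‖x‖ with hndef
  have hn0 : 0 ≤ n := norm_nonneg x
  rcases (neg_le_of_abs_le (abs_le_of_sq_le_sq (by nlinarith [sq_nonneg (x 0), sq_nonneg (x 1)])
    hn0) : -n ≤ x 2).eq_or_lt with h | h
  -- At the south pole `x 2 = -‖x‖` the eigenvector formula below degenerates; there conjugation by
  -- `σ₁` flips the sign of `σ₃`.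
  · have h0 : x 0 = 0 := by nlinarith [sq_nonneg (x 0), sq_nonneg (x 1)]
    have h1 : x 1 = 0 := by nlinarith [sq_nonneg (x 0), sq_nonneg (x 1)]
    refine ⟨pauli 0, ?_, ?_⟩
    · rw [Matrix.mem_unitaryGroup_iff, Matrix.star_eq_conjTranspose]
      ext i j
      fin_cases i <;> fin_cases j <;> simp [pauli, Matrix.conjTranspose_fin_two]
    · rw [h0, h1, ← h]
      ext i j
      fin_cases i <;> fin_cases j <;> simp [pauli, Matrix.conjTranspose_fin_two]
  · have hp : 0 < n + x 2 := by linarith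
    have hnpos : 0 < n := by
      rcases hn0.eq_or_lt with h' | h'
      · nlinarith [sq_nonneg (x 0), sq_nonneg (x 1)]
      · exact h'
    set p := n + x 2 with hpdef
    have hN : 0 < 2 * n * p := by positivity
    set N := √(2 * n * p) with hNdef
    have hN2 : N ^ 2 = 2 * n * p := Real.sq_sqrt hN.le
    have hNne : (N : ℂ) ≠ 0 := by
      exact_mod_cast (Real.sqrt_pos.mpr hN).ne'
    have hpne : (p : ℂ) ≠ 0 := by exact_mod_cast hp.ne'
    have hnne : (n : ℂ) ≠ 0 := by exact_mod_cast hnpos.ne'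
    have hN2' : (N : ℂ) ^ 2 = 2 * n * p := by exact_mod_cast hN2
    have hp' : (p : ℂ) = n + x 2 := by exact_mod_cast hpdef
    have hn' : (n : ℂ) ^ 2 = x 0 ^ 2 + x 1 ^ 2 + x 2 ^ 2 := by exact_mod_cast hn
    have hI := Complex.I_sq
    -- The columns are eigenvectors for `n` and `-n`. Each has squared length `p² + x₀² + x₁² = 2 n
    -- p`, because `x₀² + x₁² = (n - x₂) p`.
    refine ⟨(N : ℂ)⁻¹ • !![(p : ℂ), -(x 0 + x 1 * Complex.I); x 0 - x 1 * Complex.I, p], ?_, ?_⟩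
    · rw [Matrix.mem_unitaryGroup_iff, Matrix.star_eq_conjTranspose]
      ext i j
      fin_cases i <;> fin_cases j <;> simp [Matrix.mul_apply, Matrix.conjTranspose_fin_two] <;> field_simp <;> rw [hN2', hp'] <;>
        first | ring1 | linear_combination (-(x 1 : ℂ) ^ 2) * hI - hn'
    · ext i j
      fin_cases i <;> fin_cases j <;> simp [pauli, Matrix.conjTranspose_fin_two] <;> field_simp <;> rw [hN2', hp'] <;>
        first
          | ring1
          | linear_combination ((x 1 : ℂ) ^ 2 * n) * hI + n * hn'
          | linear_combination (-(x 1 : ℂ) ^ 2 * n) * hI - n * hn'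

theorem blochVector_inner (X : Mat2) (t : EuclideanSpace ℝ (Fin 3)) :
    inner ℝ (blochVector X) t = (X * ∑ i, (t i : ℂ) • pauli i).trace.re := by
  simp [blochVector, PiLp.inner_apply, Fin.sum_univ_three, Matrix.mul_add, Matrix.trace_add,
    mul_comm]

/-! ### Volume of the off-diagonal blocks -/

/-- The contractions, as the matrices `X` for which `[1, X; Xᴴ, 1]` is positive semidefinite. -/
def contractionBlocks : Set (Fin 2 × Fin 2 → ℂ) :=
  {v | (Matrix.fromBlocks 1 (Matrix.of fun i j => v (j, i)) (Matrix.of fun i j => v (j, i)).conjTranspose 1 :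
    Matrix (Fin 2 ⊕ Fin 2) (Fin 2 ⊕ Fin 2) ℂ).PosSemidef}

theorem vec_of_swap (v : Fin 2 × Fin 2 → ℂ) :
    Matrix.vec (Matrix.of fun i j => v (j, i)) = v := rfl

/-- The left matrix is the right one conjugated by the invertible `diag(L, K)`. -/
theorem fromBlocks_posSemidef_iff {L K X : Mat2} (hL : IsUnit L) (hK : IsUnit K) :
    (Matrix.fromBlocks (L * L.conjTranspose) (L * X * K.conjTranspose)
      (L * X * K.conjTranspose).conjTranspose (K * K.conjTranspose)).PosSemidef ↔
    (Matrix.fromBlocks 1 X X.conjTranspose 1).PosSemidef := by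
  have hD : IsUnit (Matrix.fromBlocks L 0 0 K) := by
    rw [Matrix.isUnit_iff_isUnit_det, Matrix.det_fromBlocks_zero₂₁]
    exact ((Matrix.isUnit_iff_isUnit_det _).mp hL).mul ((Matrix.isUnit_iff_isUnit_det _).mp hK)
  rw [← Matrix.IsUnit.posSemidef_star_right_conjugate_iff (x := Matrix.fromBlocks 1 X _ 1) hD]
  congr! 1
  simp [Matrix.star_eq_conjTranspose, Matrix.fromBlocks_conjTranspose, Matrix.fromBlocks_multiply,
    mul_assoc]

theorem Matrix.PosDef.exists_isUnit_mul_conjTranspose {A : Mat2} (hA : A.PosDef) :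
    ∃ L : Mat2, IsUnit L ∧ A = L * L.conjTranspose ∧ ‖L.det‖ ^ 2 = A.det.re := by
  obtain ⟨L, hL⟩ := hA.posSemidef.exists_eq_mul_conjTranspose
  have hdet : A.det = (‖L.det‖ ^ 2 : ℝ) := by
    rw [hL, Matrix.det_mul, Matrix.det_conjTranspose]
    simpa using Complex.mul_conj' L.det
  refine ⟨L, ?_, hL, by rw [hdet, Complex.ofReal_re]⟩
  rw [Matrix.isUnit_iff_isUnit_det, isUnit_iff_ne_zero]
  intro h
  have := hA.det_pos
  rw [hdet, h] at this
  simp at this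

/-- The volume of the set of off-diagonal blocks that complete given positive definite diagonal
blocks to a positive semidefinite matrix. -/
theorem volume_offDiagonal_blocks {A D : Mat2} (hA : A.PosDef) (hD : D.PosDef) :
    volume {v : Fin 2 × Fin 2 → ℂ | (Matrix.fromBlocks A (Matrix.of fun i j => v (j, i))
      (Matrix.of fun i j => v (j, i)).conjTranspose D).PosSemidef} =
    ENNReal.ofReal (A.det.re ^ 2 * D.det.re ^ 2) * volume contractionBlocks := by
  obtain ⟨L, hLu, rfl, hLdet⟩ := hA.exists_isUnit_mul_conjTranspose
  obtain ⟨K, hKu, rfl, hKdet⟩ := hD.exists_isUnit_mul_conjTranspose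
  -- `vec (L X Kᴴ) = (conj K ⊗ L) vec X`. The real determinant of this complex map is the squared
  -- modulus of its complex determinant `conj(det K)² det(L)²`, whence the squares of `det A` and
  -- `det D`.
  set M : Matrix (Fin 2 × Fin 2) (Fin 2 × Fin 2) ℂ :=
    Matrix.kroneckerMap (· * ·) K.conjTranspose.transpose L with hM
  have hMdet : M.det = star K.det ^ 2 * L.det ^ 2 := by
    rw [hM, Matrix.det_kronecker, Matrix.det_transpose, Matrix.det_conjTranspose]
    simp
  set T : (Fin 2 × Fin 2 → ℂ) →ₗ[ℝ] (Fin 2 × Fin 2 → ℂ) := (Matrix.toLin' M).restrictScalars ℝ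
    with hT
  have hTdet : LinearMap.det T = (L * L.conjTranspose).det.re ^ 2 * (K * K.conjTranspose).det.re ^ 2 := by
    rw [hT, LinearMap.det_restrictScalars, LinearMap.det_toLin', hMdet, Algebra.norm_complex_apply,
      ← hLdet, ← hKdet, Complex.normSq_eq_norm_sq]
    simp
    ring
  have hpos : 0 < (L * L.conjTranspose).det.re ^ 2 * (K * K.conjTranspose).det.re ^ 2 := by
    rw [← hLdet, ← hKdet]
    have h1 := ((Matrix.isUnit_iff_isUnit_det _).mp hLu).ne_zero
    have h2 := ((Matrix.isUnit_iff_isUnit_det _).mp hKu).ne_zero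
    positivity
  have himg : {v : Fin 2 × Fin 2 → ℂ | (Matrix.fromBlocks (L * L.conjTranspose)
      (Matrix.of fun i j => v (j, i)) (Matrix.of fun i j => v (j, i)).conjTranspose
      (K * K.conjTranspose)).PosSemidef} = T '' contractionBlocks := by
    have hTv : ∀ v, (Matrix.of fun i j => T v (j, i)) =
        L * (Matrix.of fun i j => v (j, i)) * K.conjTranspose := by
      intro v
      have := Matrix.kronecker_mulVec_vec L (Matrix.of fun i j => v (j, i))
        K.conjTranspose.transpose
      rw [vec_of_swap, Matrix.transpose_transpose] at this
      have h2 : T v = Matrix.vec (L * (Matrix.of fun i j => v (j, i)) * K.conjTranspose) := this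
      rw [h2]
      rfl
    have hTs : Function.Surjective T := by
      have : LinearMap.det T ≠ 0 := by rw [hTdet]; exact hpos.ne'
      exact (LinearMap.equivOfDetNeZero T this).surjective
    ext w
    obtain ⟨v, rfl⟩ := hTs w
    have hTi : Function.Injective T := by
      have : LinearMap.det T ≠ 0 := by rw [hTdet]; exact hpos.ne'
      exact (LinearMap.equivOfDetNeZero T this).injective
    rw [hTi.mem_set_image, Set.mem_ofPred_eq, hTv, fromBlocks_posSemidef_iff hLu hKu]
    rfl
  rw [himg, Measure.addHaar_image_linearMap, hTdet, abs_of_pos hpos]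

/-- The principal `2 × 2` minors `1 - ‖v (j, i)‖²` are nonnegative, so every entry lies in the unit
disc. -/
theorem volume_contractionBlocks_ne_top : volume contractionBlocks ≠ ⊤ := by
  refine ne_top_of_le_ne_top (isCompact_closedBall (0 : Fin 2 × Fin 2 → ℂ) 1).measure_lt_top.ne
    (measure_mono fun v hv => ?_)
  rw [mem_closedBall_zero_iff, pi_norm_le_iff_of_nonneg zero_le_one]
  rintro ⟨j, i⟩
  have h := (hv : Matrix.PosSemidef _).submatrix (fun k : Fin 2 => if k = 0 then Sum.inl i else Sum.inr j)
  have h2 := h.det_nonneg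
  rw [Matrix.det_fin_two] at h2
  simp [Matrix.submatrix] at h2
  have h3 : v (j, i) * (starRingEnd ℂ) (v (j, i)) = ((‖v (j, i)‖ ^ 2 : ℝ) : ℂ) := by
    simpa using Complex.mul_conj' (v (j, i))
  rw [h3] at h2
  have h4 : ‖v (j, i)‖ ^ 2 ≤ 1 := by exact_mod_cast h2
  exact (sq_le_one_iff₀ (norm_nonneg _)).mp h4

theorem volume_contractionBlocks_ne_zero : volume contractionBlocks ≠ 0 := by
  have hb : Metric.ball (0 : Fin 2 × Fin 2 → ℂ) (1 / 4) ⊆ contractionBlocks := by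
    intro v hv
    rw [mem_ball_zero_iff] at hv
    have hv' : ∀ p, ‖v p‖ ≤ 1 / 4 := fun p => (norm_le_pi_norm v p).trans hv.le
    refine Matrix.PosSemidef.of_dotProduct_mulVec_nonneg ?_ fun x => ?_
    · rw [Matrix.isHermitian_fromBlocks_iff]
      simp
    · have key : star x ⬝ᵥ Matrix.mulVec (Matrix.fromBlocks 1 (Matrix.of fun i j => v (j, i))
          (Matrix.of fun i j => v (j, i)).conjTranspose 1) x =
          ((∑ k, ‖x k‖ ^ 2 + 2 * (∑ i : Fin 2, ∑ j : Fin 2,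
            (star (x (.inl i)) * v (j, i) * x (.inr j)).re) : ℝ) : ℂ) := by
        simp only [← Complex.normSq_eq_norm_sq, Complex.normSq_apply]
        apply Complex.ext <;>
          simp [dotProduct, Matrix.mulVec, Fintype.sum_sum_type, Fin.sum_univ_two,
            Matrix.one_apply] <;> ring
      rw [key]
      -- AM-GM with entries at most `1/4`. Each coordinate of `x` occurs in two of the four cross
      -- terms, so together they cost at most half of `∑ ‖x k‖²`.
      have hij : ∀ i j : Fin 2, -(‖x (.inl i)‖ ^ 2 + ‖x (.inr j)‖ ^ 2) / 8 ≤
          (star (x (.inl i)) * v (j, i) * x (.inr j)).re := by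
        intro i j
        have h1 := Complex.abs_re_le_norm (star (x (.inl i)) * v (j, i) * x (.inr j))
        rw [norm_mul, norm_mul, norm_star] at h1
        have h2 := neg_le_of_abs_le h1
        have h3 := mul_le_mul_of_nonneg_left (hv' (j, i))
          (mul_nonneg (norm_nonneg (x (.inl i))) (norm_nonneg (x (.inr j))))
        nlinarith [sq_nonneg (‖x (.inl i)‖ - ‖x (.inr j)‖)]
      have h00 := hij 0 0
      have h01 := hij 0 1
      have h10 := hij 1 0
      have h11 := hij 1 1
      refine Complex.zero_le_real.mpr ?_
      simp only [Fintype.sum_sum_type, Fin.sum_univ_two]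
      nlinarith [sq_nonneg ‖x (.inl 0)‖, sq_nonneg ‖x (.inl 1)‖, sq_nonneg ‖x (.inr 0)‖,
        sq_nonneg ‖x (.inr 1)‖]
  exact ((Metric.isOpen_ball.measure_pos volume ⟨0, by simp⟩).trans_le (measure_mono hb)).ne'

/-! ### Disintegration over the upper left block -/

/-- The equivalence between pairs of an output and an input index and block indices. -/
def blockEquiv : Fin 2 ⊕ Fin 2 ≃ Fin 2 × Fin 2 where
  toFun := Sum.elim (fun i => (0, i)) fun i => (1, i)
  invFun p := if p.1 = 0 then .inl p.2 else .inr p.2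
  left_inv := by rintro (i | i) <;> simp
  right_inv := by rintro ⟨i, j⟩; fin_cases i <;> simp

/-- The upper left block of the Choi matrix, in adapted coordinates. -/
noncomputable def upperBlock (s w : ℝ) (c : ℂ) : Mat2 :=
  !![((1 + s + w) / 2 : ℂ), c; star c, ((1 + s - w) / 2 : ℂ)]

/-- The linear part of an affine parametrization of the channel coordinates, whose first coordinate
is the third Bloch coordinate of the image of `(1 + r₀ σ₃) / 2`. -/
noncomputable def channelParamLin (r₀ : ℝ) :
    (ℝ × ℝ × ℂ × (Fin 2 × Fin 2 → ℂ)) ≃ₗ[ℝ] (ℝ × ℝ × ℂ × ℂ × ℂ × ℂ × ℂ) where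
  toFun y := ((y.1 - r₀ * y.2.1 + y.2.1) / 2, (y.1 - r₀ * y.2.1 - y.2.1) / 2,
    y.2.2.2 (0, 0), y.2.2.1, y.2.2.2 (1, 0), star (y.2.2.2 (0, 1)), y.2.2.2 (1, 1))
  map_add' x y := by
    simp only [Prod.fst_add, Prod.snd_add, Pi.add_apply, star_add, Prod.mk_add_mk, Prod.mk.injEq,
      and_true]
    constructor <;> ring
  map_smul' t y := by
    simp only [Prod.smul_fst, Prod.smul_snd, Pi.smul_apply, star_smul, Prod.smul_mk, smul_eq_mul,
      RingHom.id_apply, Prod.mk.injEq, star_trivial, and_true]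
    constructor <;> ring
  invFun x := (x.1 + x.2.1 + r₀ * (x.1 - x.2.1), x.1 - x.2.1, x.2.2.2.1,
    fun p => !![x.2.2.1, star x.2.2.2.2.2.1; x.2.2.2.2.1, x.2.2.2.2.2.2] p.1 p.2)
  left_inv y := by
    obtain ⟨z, w, c, v⟩ := y
    refine Prod.ext (by simp; ring) (Prod.ext (by simp; ring) (Prod.ext rfl ?_))
    funext p
    obtain ⟨i, j⟩ := p
    fin_cases i <;> fin_cases j <;> simp
  right_inv x := by
    obtain ⟨a, f, b, c, d, e, g⟩ := x
    refine Prod.ext (by simp) (Prod.ext (by simp) (by simp))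

/-- An affine parametrization of the channel coordinates, whose first coordinate is the third Bloch
coordinate of the image of `(1 + r₀ σ₃) / 2`. -/
noncomputable def channelParam (r₀ : ℝ) (y : ℝ × ℝ × ℂ × (Fin 2 × Fin 2 → ℂ)) :
    ℝ × ℝ × ℂ × ℂ × ℂ × ℂ × ℂ :=
  channelParamLin r₀ y + (1 / 2, 1 / 2, 0, 0, 0, 0, 0)

/-- Trace preservation makes the two diagonal blocks sum to `1`, and the third Bloch coordinate is
`z = s + r₀ w`. -/
theorem channelParam_mem_range_coords_iff (r₀ z w : ℝ) (c : ℂ) (v : Fin 2 × Fin 2 → ℂ) :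
    channelParam r₀ (z, w, c, v) ∈ Set.range QubitChannel.coords ↔
      (Matrix.fromBlocks (upperBlock (z - r₀ * w) w c) (Matrix.of fun i j => v (j, i))
        (Matrix.of fun i j => v (j, i)).conjTranspose
        (1 - upperBlock (z - r₀ * w) w c)).PosSemidef := by
  rw [QubitChannel.mem_range_coords_iff, ← Matrix.posSemidef_submatrix_equiv blockEquiv]
  congr! 1
  ext i j
  rcases i with i | i <;> rcases j with j | j <;> fin_cases i <;> fin_cases j <;>
    simp [blockEquiv, choiMatrix, linOf, channelParam, channelParamLin, upperBlock] <;> ring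

theorem Matrix.IsHermitian.posDef_fin_two_iff {A : Mat2} (hA : A.IsHermitian) :
    A.PosDef ↔ 0 < A.trace.re ∧ 0 < A.det.re := by
  rw [hA.posDef_iff_eigenvalues_pos, hA.trace_eq_sum_eigenvalues, hA.det_eq_prod_eigenvalues]
  simp only [Fin.sum_univ_two, Fin.prod_univ_two, Fin.forall_fin_two]
  norm_cast
  constructor
  · rintro ⟨h0, h1⟩
    exact ⟨add_pos h0 h1, mul_pos h0 h1⟩
  · rintro ⟨h0, h1⟩
    rcases mul_pos_iff.mp h1 with h | h
    · exact h
    · exact absurd h0 (not_lt.mpr (add_nonpos h.1.le h.2.le))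

theorem isHermitian_upperBlock (s w : ℝ) (c : ℂ) : (upperBlock s w c).IsHermitian := by
  ext i j
  fin_cases i <;> fin_cases j <;> simp [upperBlock]

theorem one_sub_upperBlock (s w : ℝ) (c : ℂ) :
    1 - upperBlock s w c = upperBlock (-s) (-w) (-c) := by
  ext i j
  fin_cases i <;> fin_cases j <;> simp [upperBlock] <;> ring

theorem det_upperBlock (s w : ℝ) (c : ℂ) :
    (upperBlock s w c).det = (((1 + s) ^ 2 - w ^ 2) / 4 - ‖c‖ ^ 2 : ℝ) := by
  have : c * star c = ((‖c‖ ^ 2 : ℝ) : ℂ) := by simpa using Complex.mul_conj' c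
  rw [upperBlock, Matrix.det_fin_two_of, this]
  push_cast
  ring

theorem posDef_upperBlock_iff (s w : ℝ) (c : ℂ) :
    (upperBlock s w c).PosDef ↔ -1 < s ∧ ‖c‖ ^ 2 < ((1 + s) ^ 2 - w ^ 2) / 4 := by
  rw [(isHermitian_upperBlock s w c).posDef_fin_two_iff, det_upperBlock, Complex.ofReal_re, sub_pos]
  have : (upperBlock s w c).trace = ((1 + s : ℝ) : ℂ) := by
    simp [upperBlock, Matrix.trace_fin_two]
    ring
  rw [this, Complex.ofReal_re, neg_lt_iff_pos_add']

/-- The joint density, up to a constant, of the upper left block of the Choi matrix. -/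
noncomputable def blockDensity (s w u : ℝ) : ENNReal :=
  if |s| < 1 ∧ u < ((1 - |s|) ^ 2 - w ^ 2) / 4 then
    ENNReal.ofReal ((((1 + s) ^ 2 - w ^ 2) / 4 - u) ^ 2 * (((1 - s) ^ 2 - w ^ 2) / 4 - u) ^ 2)
  else 0

theorem measurable_blockDensity :
    Measurable fun p : ℝ × ℝ × ℝ => blockDensity p.1 p.2.1 p.2.2 := by
  unfold blockDensity
  refine Measurable.ite (MeasurableSet.inter (s₁ := {p : ℝ × ℝ × ℝ | |p.1| < 1})
    (s₂ := {p : ℝ × ℝ × ℝ | p.2.2 < ((1 - |p.1|) ^ 2 - p.2.1 ^ 2) / 4})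
    (measurableSet_lt ?_ measurable_const) (measurableSet_lt ?_ ?_)) (ENNReal.measurable_ofReal.comp ?_)
    measurable_const
  all_goals exact Continuous.measurable (by fun_prop)

/-- The two determinants differ by `s`, so the binding condition is the one with `1 - |s|`. -/
theorem posDef_upperBlock_and_iff (s w : ℝ) (c : ℂ) :
    ((upperBlock s w c).PosDef ∧ (1 - upperBlock s w c).PosDef) ↔
      |s| < 1 ∧ ‖c‖ ^ 2 < ((1 - |s|) ^ 2 - w ^ 2) / 4 := by
  rw [one_sub_upperBlock, posDef_upperBlock_iff, posDef_upperBlock_iff, norm_neg, neg_sq, abs_lt]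
  rcases abs_cases s with ⟨h, h'⟩ | ⟨h, h'⟩ <;> rw [h] <;> constructor <;>
    rintro ⟨h1, h2⟩ <;> refine ⟨⟨?_, ?_⟩, ?_⟩ <;> first | nlinarith | (constructor <;> nlinarith)

/-- Semidefinite diagonal blocks that are not definite have zero determinant, which confines `c` to
two circles, a null set. Elsewhere, either both blocks are definite or the fibre is empty. -/
theorem volume_fiber_ae_eq (s w : ℝ) :
    (fun c : ℂ => volume {v : Fin 2 × Fin 2 → ℂ | (Matrix.fromBlocks (upperBlock s w c)
      (Matrix.of fun i j => v (j, i)) (Matrix.of fun i j => v (j, i)).conjTranspose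
      (1 - upperBlock s w c)).PosSemidef}) =ᵐ[volume]
    fun c => blockDensity s w (‖c‖ ^ 2) * volume contractionBlocks := by
  have hnull : ∀ t : ℝ, ∀ᵐ c : ℂ, t - ‖c‖ ^ 2 ≠ 0 := by
    intro t
    have h := Measure.addHaar_sphere (volume : Measure ℂ) 0 √t
    filter_upwards [measure_eq_zero_iff_ae_notMem.mp h] with c hc h0
    apply hc
    rw [mem_sphere_zero_iff_norm, sub_eq_zero.mp h0, Real.sqrt_sq (norm_nonneg c)]
  filter_upwards [hnull (((1 + s) ^ 2 - w ^ 2) / 4), hnull (((1 - s) ^ 2 - w ^ 2) / 4)] with c h1 h2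
  have hdet2 : (1 - upperBlock s w c).det = (((1 - s) ^ 2 - w ^ 2) / 4 - ‖c‖ ^ 2 : ℝ) := by
    rw [one_sub_upperBlock, det_upperBlock, norm_neg, neg_sq, sub_eq_add_neg 1 s]
  by_cases hpd : (upperBlock s w c).PosDef ∧ (1 - upperBlock s w c).PosDef
  · rw [volume_offDiagonal_blocks hpd.1 hpd.2, blockDensity,
      if_pos ((posDef_upperBlock_and_iff s w c).mp hpd), hdet2, det_upperBlock]
    rfl
  · rw [blockDensity, if_neg (mt (posDef_upperBlock_and_iff s w c).mpr hpd), zero_mul]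
    convert measure_empty (μ := (volume : Measure (Fin 2 × Fin 2 → ℂ)))
    refine Set.eq_empty_iff_forall_notMem.mpr fun v hv => hpd ⟨?_, ?_⟩
    · have : (upperBlock s w c).PosSemidef := (hv : Matrix.PosSemidef _).submatrix Sum.inl
      rw [this.posDef_iff_det_ne_zero, det_upperBlock]
      exact_mod_cast h1
    · have : (1 - upperBlock s w c).PosSemidef := (hv : Matrix.PosSemidef _).submatrix Sum.inr
      rw [this.posDef_iff_det_ne_zero, hdet2]
      exact_mod_cast h2

/-- The third Bloch coordinate of the image of `(1 + r₀ σ₃) / 2`, as a function of the channel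
coordinates. -/
def outputCoord (r₀ : ℝ) (x : ℝ × ℝ × ℂ × ℂ × ℂ × ℂ × ℂ) : ℝ :=
  x.1 + x.2.1 - 1 + r₀ * (x.1 - x.2.1)

theorem outputCoord_channelParam (r₀ : ℝ) (y : ℝ × ℝ × ℂ × (Fin 2 × Fin 2 → ℂ)) :
    outputCoord r₀ (channelParam r₀ y) = y.1 := by
  simp [outputCoord, channelParam, channelParamLin]
  ring

/-- Tonelli in the coordinates `(z, w, c, v)`: the integral over `v` is the fibre volume, and `C`
collects the Jacobian and the volume of the contractions. -/
theorem exists_lintegral_range_coords_eq (r₀ : ℝ) :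
    ∃ C : ENNReal, C ≠ 0 ∧ C ≠ ⊤ ∧ ∀ φ : ℝ → ENNReal, Measurable φ →
      ∫⁻ x in Set.range QubitChannel.coords, φ (outputCoord r₀ x) =
        C * ∫⁻ z, φ z * ∫⁻ w, ∫⁻ c : ℂ, blockDensity (z - r₀ * w) w (‖c‖ ^ 2) := by
  obtain ⟨k, hk0, hkt, hk⟩ := exists_map_affine_eq_smul
    (volume : Measure (ℝ × ℝ × ℂ × (Fin 2 × Fin 2 → ℂ)))
    (volume : Measure (ℝ × ℝ × ℂ × ℂ × ℂ × ℂ × ℂ)) (channelParamLin r₀)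
    (1 / 2, 1 / 2, 0, 0, 0, 0, 0)
  have hk' : (volume : Measure (ℝ × ℝ × ℂ × (Fin 2 × Fin 2 → ℂ))).map (channelParam r₀) =
    k • volume := hk
  have hpm : Measurable (channelParam r₀) :=
    ((channelParamLin r₀).toLinearMap.continuous_of_finiteDimensional.add
      continuous_const).measurable
  have hom : Measurable (outputCoord r₀) := by unfold outputCoord; fun_prop
  have hQ := QubitChannel.isClosed_range_coords.measurableSet
  refine ⟨k⁻¹ * volume contractionBlocks,
    mul_ne_zero (ENNReal.inv_ne_zero.mpr hkt) volume_contractionBlocks_ne_zero,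
    ENNReal.mul_ne_top (ENNReal.inv_ne_top.mpr hk0) volume_contractionBlocks_ne_top,
    fun φ hφ => ?_⟩
  have hS : MeasurableSet (channelParam r₀ ⁻¹' Set.range QubitChannel.coords) := hpm hQ
  have h1 : ∫⁻ y in channelParam r₀ ⁻¹' Set.range QubitChannel.coords, φ y.1 =
      k * ∫⁻ x in Set.range QubitChannel.coords, φ (outputCoord r₀ x) := by
    rw [← smul_eq_mul, ← lintegral_smul_measure, ← Measure.restrict_smul, ← hk',
      setLIntegral_map hQ (by exact hφ.comp hom) hpm]
    simp only [outputCoord_channelParam]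
  have h2 : ∫⁻ y in channelParam r₀ ⁻¹' Set.range QubitChannel.coords, φ y.1 =
      (∫⁻ z, φ z * ∫⁻ w, ∫⁻ c : ℂ, blockDensity (z - r₀ * w) w (‖c‖ ^ 2)) *
        volume contractionBlocks := by
    have hm : Measurable ((channelParam r₀ ⁻¹' Set.range QubitChannel.coords).indicator
        fun y => φ y.1) := (hφ.comp measurable_fst).indicator hS
    have hd : Measurable fun p : ℝ × ℝ × ℂ =>
        blockDensity (p.1 - r₀ * p.2.1) p.2.1 (‖p.2.2‖ ^ 2) :=
      measurable_blockDensity.comp (f := fun p : ℝ × ℝ × ℂ => (p.1 - r₀ * p.2.1, p.2.1, ‖p.2.2‖ ^ 2))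
        (by fun_prop)
    have hd1 : ∀ z, Measurable fun p : ℝ × ℂ => blockDensity (z - r₀ * p.1) p.1 (‖p.2‖ ^ 2) :=
      fun z => hd.comp (measurable_prodMk_left (x := z))
    rw [← lintegral_indicator hS, Measure.volume_eq_prod, lintegral_prod _ hm.aemeasurable,
      ← lintegral_mul_const' _ _ volume_contractionBlocks_ne_top]
    refine lintegral_congr fun z => ?_
    have hm1 : Measurable fun y => (channelParam r₀ ⁻¹' Set.range QubitChannel.coords).indicator
        (fun y => φ y.1) (z, y) := hm.comp (measurable_prodMk_left (x := z))
    rw [Measure.volume_eq_prod, lintegral_prod _ hm1.aemeasurable, mul_assoc,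
      ← lintegral_mul_const' _ _ volume_contractionBlocks_ne_top,
      ← lintegral_const_mul _ (by exact ((hd1 z).lintegral_prod_right').mul_const _)]
    refine lintegral_congr fun w => ?_
    have hd2 : Measurable fun c : ℂ => blockDensity (z - r₀ * w) w (‖c‖ ^ 2) :=
      (hd1 z).comp (measurable_prodMk_left (x := w))
    have hm2 : Measurable fun y => (channelParam r₀ ⁻¹' Set.range QubitChannel.coords).indicator
        (fun y => φ y.1) (z, w, y) := hm1.comp (measurable_prodMk_left (x := w))
    rw [Measure.volume_eq_prod, lintegral_prod _ hm2.aemeasurable,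
      ← lintegral_mul_const' _ _ volume_contractionBlocks_ne_top,
      ← lintegral_const_mul _ (hd2.mul_const _)]
    refine lintegral_congr_ae ?_
    filter_upwards [volume_fiber_ae_eq (z - r₀ * w) w] with c hc
    rw [← hc]
    have hvm : MeasurableSet {v : Fin 2 × Fin 2 → ℂ |
        (z, w, c, v) ∈ channelParam r₀ ⁻¹' Set.range QubitChannel.coords} :=
      (measurable_prodMk_left.comp (measurable_prodMk_left.comp measurable_prodMk_left)) hS
    have hset : {v : Fin 2 × Fin 2 → ℂ | (Matrix.fromBlocks (upperBlock (z - r₀ * w) w c)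
        (Matrix.of fun i j => v (j, i)) (Matrix.of fun i j => v (j, i)).conjTranspose
        (1 - upperBlock (z - r₀ * w) w c)).PosSemidef} = {v : Fin 2 × Fin 2 → ℂ |
        (z, w, c, v) ∈ channelParam r₀ ⁻¹' Set.range QubitChannel.coords} :=
      Set.ext fun v => (channelParam_mem_range_coords_iff r₀ z w c v).symm
    rw [hset, ← lintegral_indicator_const hvm]
    rfl
  rw [h2] at h1
  rw [mul_assoc, mul_comm (volume _), h1, ← mul_assoc, ENNReal.inv_mul_cancel hk0 hkt, one_mul]

/-! ### Integrating out the off-diagonal entry -/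

theorem lintegral_comp_sq_Ioi (F : ℝ → ENNReal) :
    ∫⁻ r in Set.Ioi (0 : ℝ), ENNReal.ofReal (2 * r) * F (r ^ 2) = ∫⁻ u in Set.Ioi 0, F u := by
  have himg : (fun r : ℝ => r ^ 2) '' Set.Ioi 0 = Set.Ioi 0 := by
    ext u
    constructor
    · rintro ⟨r, hr, rfl⟩
      exact pow_pos (Set.mem_Ioi.mp hr) 2
    · intro hu
      exact ⟨√u, Real.sqrt_pos.mpr hu, Real.sq_sqrt (le_of_lt hu)⟩
  have hinj : Set.InjOn (fun r : ℝ => r ^ 2) (Set.Ioi 0) := fun a ha b hb h =>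
    (pow_left_inj₀ (le_of_lt ha) (le_of_lt hb) two_ne_zero).mp h
  have h := lintegral_image_eq_lintegral_abs_deriv_mul measurableSet_Ioi
    (fun r _ => (hasDerivAt_pow 2 r).hasDerivWithinAt) hinj F
  rw [himg] at h
  rw [h]
  refine setLIntegral_congr_fun measurableSet_Ioi fun r hr => ?_
  have hr' : (0 : ℝ) < r := hr
  simp [abs_of_pos hr']

theorem Complex.lintegral_comp_norm_sq {F : ℝ → ENNReal} (hF : Measurable F) :
    ∫⁻ c : ℂ, F (‖c‖ ^ 2) = ENNReal.ofReal Real.pi * ∫⁻ u in Set.Ioi 0, F u := by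
  rw [← Complex.lintegral_comp_polarCoord_symm, ← lintegral_comp_sq_Ioi]
  have htarget : polarCoord.target = Set.Ioi (0 : ℝ) ×ˢ Set.Ioo (-Real.pi) Real.pi := rfl
  have hm : Measurable fun p : ℝ × ℝ =>
      ENNReal.ofReal p.1 • F (‖Complex.polarCoord.symm p‖ ^ 2) := by
    simp only [Complex.norm_polarCoord_symm, smul_eq_mul]
    exact (ENNReal.measurable_ofReal.comp measurable_fst).mul
      (hF.comp ((measurable_fst.norm).pow_const 2))
  rw [htarget, Measure.volume_eq_prod, ← Measure.prod_restrict, lintegral_prod _ hm.aemeasurable,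
    ← lintegral_const_mul' _ _ ENNReal.ofReal_ne_top]
  refine setLIntegral_congr_fun measurableSet_Ioi fun r hr => ?_
  have hr' : (0 : ℝ) < r := hr
  simp only [Complex.norm_polarCoord_symm, sq_abs, lintegral_const, smul_eq_mul,
    Measure.restrict_apply MeasurableSet.univ, Set.univ_inter, Real.volume_Ioo]
  rw [sub_neg_eq_add, mul_right_comm, ← mul_assoc, ← ENNReal.ofReal_mul hr'.le,
    ← ENNReal.ofReal_mul Real.pi_pos.le]
  congr 2
  ring

theorem lintegral_Ioo_ofReal_of_hasDerivAt {F f : ℝ → ℝ} {a b : ℝ} (hab : a ≤ b)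
    (hF : ∀ x, HasDerivAt F (f x) x) (hf : Continuous f) (h0 : ∀ x ∈ Set.Ioo a b, 0 ≤ f x) :
    ∫⁻ x in Set.Ioo a b, ENNReal.ofReal (f x) = ENNReal.ofReal (F b - F a) := by
  rw [← ofReal_integral_eq_lintegral_ofReal
    ((hf.integrableOn_Icc (a := a) (b := b)).mono_set Set.Ioo_subset_Icc_self)
    ((ae_restrict_iff' measurableSet_Ioo).mpr (Filter.Eventually.of_forall h0)),
    ← integral_Ioc_eq_integral_Ioo, ← intervalIntegral.integral_of_le hab,
    intervalIntegral.integral_eq_sub_of_hasDerivAt (fun x _ => hF x) (hf.intervalIntegrable _ _)]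

/-- The density of the diagonal of the upper left block of the Choi matrix, up to a constant. -/
noncomputable def profile (s w : ℝ) : ℝ :=
  (((1 - s) ^ 2 - w ^ 2) / 4) ^ 5 / 5 + s * (((1 - s) ^ 2 - w ^ 2) / 4) ^ 4 / 2 +
    s ^ 2 * (((1 - s) ^ 2 - w ^ 2) / 4) ^ 3 / 3

theorem blockDensity_eq (s w u : ℝ) :
    blockDensity s w u = if |s| < 1 ∧ u < ((1 - |s|) ^ 2 - w ^ 2) / 4 then
      ENNReal.ofReal ((((1 - |s|) ^ 2 - w ^ 2) / 4 - u + |s|) ^ 2 *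
        (((1 - |s|) ^ 2 - w ^ 2) / 4 - u) ^ 2) else 0 := by
  unfold blockDensity
  congr 2
  rcases abs_cases s with ⟨h, -⟩ | ⟨h, -⟩ <;> rw [h] <;> ring

/-- With `m` the smaller determinant at `c = 0` and `t = m - u`, the integral is `∫₀ᵐ (t + |s|)² t²
dt`, which is `profile |s| w`. -/
theorem lintegral_blockDensity (s w : ℝ) :
    ∫⁻ c : ℂ, blockDensity s w (‖c‖ ^ 2) = ENNReal.ofReal Real.pi *
      if |s| + |w| < 1 then ENNReal.ofReal (profile |s| w) else 0 := by
  rw [Complex.lintegral_comp_norm_sq (F := blockDensity s w) (measurable_blockDensity.comp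
    (f := fun u : ℝ => (s, w, u)) (by fun_prop))]
  congr 1
  simp only [blockDensity_eq]
  set σ := |s| with hσ
  have hσ0 : 0 ≤ σ := abs_nonneg s
  have hw0 : 0 ≤ |w| := abs_nonneg w
  have hw2 : |w| ^ 2 = w ^ 2 := sq_abs w
  set m := ((1 - σ) ^ 2 - w ^ 2) / 4 with hm
  by_cases h : σ + |w| < 1
  · have hσ1 : σ < 1 := by linarith
    have hmpos : 0 < m := by rw [hm, ← hw2]; nlinarith
    rw [if_pos h]
    have : ∀ u, (if σ < 1 ∧ u < m then ENNReal.ofReal ((m - u + σ) ^ 2 * (m - u) ^ 2) else 0) =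
        (Set.Iio m).indicator (fun u => ENNReal.ofReal ((m - u + σ) ^ 2 * (m - u) ^ 2)) u := by
      intro u
      simp [Set.indicator_apply, hσ1]
    simp_rw [this]
    rw [lintegral_indicator measurableSet_Iio, Measure.restrict_restrict measurableSet_Iio,
      Set.inter_comm, Set.Ioi_inter_Iio, lintegral_Ioo_ofReal_of_hasDerivAt
        (F := fun u => -((m - u) ^ 5 / 5 + σ * (m - u) ^ 4 / 2 + σ ^ 2 * (m - u) ^ 3 / 3))
        hmpos.le (fun u => ?_) (by fun_prop) (fun u _ => by positivity)]
    · congr 1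
      rw [profile, ← hm]
      ring
    · have h1 : HasDerivAt (fun u => m - u) (-1) u := by simpa using (hasDerivAt_id u).const_sub m
      refine ((((h1.pow 5).div_const 5).add (((h1.pow 4).const_mul σ).div_const 2)).add
        (((h1.pow 3).const_mul (σ ^ 2)).div_const 3)).neg.congr_deriv ?_
      push_cast
      ring
  · rw [if_neg h]
    have : ∀ u ∈ Set.Ioi (0 : ℝ), (if σ < 1 ∧ u < m then
        ENNReal.ofReal ((m - u + σ) ^ 2 * (m - u) ^ 2) else 0) = 0 := by
      intro u hu
      refine if_neg fun ⟨h1, h2⟩ => h ?_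
      have h3 : 0 < m := lt_trans hu h2
      rw [hm, ← hw2] at h3
      nlinarith
    rw [setLIntegral_congr_fun measurableSet_Ioi this, lintegral_zero]

/-! ### Primitives along the line `s + r₀ w = z` -/

/-- A primitive of a parametrization of `profile` along a line, see `hasDerivAt_profilePrimitive`. -/
noncomputable def profilePrimitive (q r σ τ y : ℝ) : ℝ :=
  q ^ 3 * σ ^ 2 / 12 * y ^ 4 +
  (q ^ 4 * σ / 10 - (3 * q ^ 2 * r * σ ^ 2 + 2 * q ^ 3 * σ * τ) / 15) * y ^ 5 +
  (q ^ 5 / 30 - (4 * q ^ 3 * r * σ + q ^ 4 * τ) / 12 +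
    (3 * q * r ^ 2 * σ ^ 2 + 6 * q ^ 2 * r * σ * τ + q ^ 3 * τ ^ 2) / 18) * y ^ 6 +
  (-(q ^ 4 * r) / 7 + (6 * q ^ 2 * r ^ 2 * σ + 4 * q ^ 3 * r * τ) / 14 -
    (r ^ 3 * σ ^ 2 + 6 * q * r ^ 2 * σ * τ + 3 * q ^ 2 * r * τ ^ 2) / 21) * y ^ 7 +
  (q ^ 3 * r ^ 2 / 4 - (4 * q * r ^ 3 * σ + 6 * q ^ 2 * r ^ 2 * τ) / 16 +
    (2 * r ^ 3 * σ * τ + 3 * q * r ^ 2 * τ ^ 2) / 24) * y ^ 8 +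
  (-(2 * q ^ 2 * r ^ 3) / 9 + (r ^ 4 * σ + 4 * q * r ^ 3 * τ) / 18 - r ^ 3 * τ ^ 2 / 27) * y ^ 9 +
  (q * r ^ 4 / 10 - r ^ 4 * τ / 20) * y ^ 10 - r ^ 5 / 55 * y ^ 11

theorem hasDerivAt_profilePrimitive (q r σ τ y : ℝ) :
    HasDerivAt (profilePrimitive q r σ τ)
      ((y * (q - r * y)) ^ 5 / 5 + (σ - τ * y) * (y * (q - r * y)) ^ 4 / 2 +
        (σ - τ * y) ^ 2 * (y * (q - r * y)) ^ 3 / 3) y := by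
  have h (c : ℝ) (n : ℕ) : HasDerivAt (fun y : ℝ => c * y ^ n) (c * (n * y ^ (n - 1))) y :=
    (hasDerivAt_pow n y).const_mul c
  refine ((((((((h _ 4).add (h _ 5)).add (h _ 6)).add (h _ 7)).add (h _ 8)).add (h _ 9)).add
    (h _ 10)).sub (h _ 11)).congr_deriv ?_
  push_cast
  ring

/-- Here `y = (1 - s + w)/2`. On the line, `s` and `((1 - s)² - w²)/4` become `1/(1 + r₀)` times
polynomials in `y`, and `profile` is homogeneous of degree five in these two quantities. -/
theorem profile_eq {r₀ : ℝ} (h : 0 < 1 + r₀) (z w : ℝ) :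
    profile (z - r₀ * w) w = 1 / (1 + r₀) ^ 5 *
      ((((1 - z + (1 + r₀) * w) / 2) * (1 - z - (1 - r₀) * ((1 - z + (1 + r₀) * w) / 2))) ^ 5 / 5 +
        (r₀ + z - 2 * r₀ * ((1 - z + (1 + r₀) * w) / 2)) *
        (((1 - z + (1 + r₀) * w) / 2) * (1 - z - (1 - r₀) * ((1 - z + (1 + r₀) * w) / 2))) ^ 4 / 2 +
        (r₀ + z - 2 * r₀ * ((1 - z + (1 + r₀) * w) / 2)) ^ 2 *
        (((1 - z + (1 + r₀) * w) / 2) * (1 - z - (1 - r₀) * ((1 - z + (1 + r₀) * w) / 2))) ^ 3 / 3) := by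
  have hN : 1 + r₀ ≠ 0 := h.ne'
  set y := (1 - z + (1 + r₀) * w) / 2 with hy
  have hm : ((1 - (z - r₀ * w)) ^ 2 - w ^ 2) / 4 = y * (1 - z - (1 - r₀) * y) / (1 + r₀) := by
    rw [hy]
    field_simp
    ring
  have hs : z - r₀ * w = (r₀ + z - 2 * r₀ * y) / (1 + r₀) := by
    rw [hy]
    field_simp
    ring
  rw [profile, hm, hs]
  field_simp

/-- Replacing `s` by `-s` raises `m` by `s`. Shifting the variable in `∫₀ᵐ t² (t + s)² dt` then adds
`∫₋ₛ⁰ t² (t + s)² dt = s⁵/30`. -/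
theorem profile_neg (s w : ℝ) : profile (-s) w = profile s w + s ^ 5 / 30 := by
  unfold profile
  ring

theorem hasDerivAt_profile {r₀ : ℝ} (h : 0 < 1 + r₀) (z w : ℝ) :
    HasDerivAt (fun w => 2 / (1 + r₀) ^ 6 *
      profilePrimitive (1 - z) (1 - r₀) (r₀ + z) (2 * r₀) ((1 - z + (1 + r₀) * w) / 2))
      (profile (z - r₀ * w) w) w := by
  have hN : 1 + r₀ ≠ 0 := h.ne'
  have h1 : HasDerivAt (fun w => (1 - z + (1 + r₀) * w) / 2) ((1 + r₀) / 2) w := by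
    simpa using (((hasDerivAt_id w).const_mul (1 + r₀)).const_add (1 - z)).div_const 2
  refine (((hasDerivAt_profilePrimitive (1 - z) (1 - r₀) (r₀ + z) (2 * r₀) _).comp w h1).const_mul
    (2 / (1 + r₀) ^ 6)).congr_deriv ?_
  rw [profile_eq h]
  field_simp

/-- The tail integral of `kappa r r₀ / r` over `[z, 1]` for `r₀ ≤ z`. -/
noncomputable def tailAbove (r₀ z : ℝ) : ℝ :=
  40 / (1 - r₀ ^ 2) ^ 6 * (3 * (1 - r₀ ^ 2) ^ 2 * (1 - z) ^ 7 - 6 * (1 - r₀ ^ 2) * (1 - z) ^ 8 +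
    (4 - 2 * r₀ ^ 2 / 3) * (1 - z) ^ 9 - (1 - z) ^ 10 + (1 - z) ^ 11 / 11)

/-- The tail integral of `kappa r r₀ / r` over `[z, 1]` for `z ≤ r₀`. -/
noncomputable def tailBelow (r₀ z : ℝ) : ℝ :=
  40 / (r₀ * (1 + r₀) ^ 6) * (7 / 2 * (r₀ ^ 6 - z ^ 6) -
      (6 * r₀ ^ 2 + 36 * r₀) / 4 * (r₀ ^ 4 - z ^ 4) +
      (r₀ ^ 4 + 6 * r₀ ^ 3 + 12 * r₀ ^ 2 + 2 * r₀) / 2 * (r₀ ^ 2 - z ^ 2)) +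
    40 / (1 + r₀) ^ 6 * (1 - r₀) ^ 3 * (3 * (1 + r₀) ^ 2 - 6 * (1 + r₀) + 4 - 2 * r₀ ^ 2 / 3 -
      (1 - r₀) + (1 - r₀) ^ 2 / 11)

/-- The argument `(1 - z)/(1 - r₀)` is the root of `q - r y`, where the line leaves the square when
`r₀ ≤ z`. -/
theorem profilePrimitive_above {r₀ z : ℝ} (h0 : 0 ≤ r₀) (h1 : r₀ < 1) :
    2 / (1 + r₀) ^ 6 * profilePrimitive (1 - z) (1 - r₀) (r₀ + z) (2 * r₀) ((1 - z) / (1 - r₀)) =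
      tailAbove r₀ z / 25200 := by
  have ha : (1 + r₀) ≠ 0 := by positivity
  have hb : (1 - r₀) ≠ 0 := (sub_pos.mpr h1).ne'
  have hc : 1 - r₀ ^ 2 = (1 + r₀) * (1 - r₀) := by ring
  rw [tailAbove, profilePrimitive, hc]
  field_simp
  ring

/-- For `z < r₀` the line leaves the square at `y = 1`, where `s < 0`; the subtracted term is the
correction coming from `profile_neg`. -/
theorem profilePrimitive_below {r₀ z : ℝ} (h0 : 0 < r₀) :
    2 / (1 + r₀) ^ 6 * profilePrimitive (1 - z) (1 - r₀) (r₀ + z) (2 * r₀) 1 -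
      (r₀ - z) ^ 6 / (180 * r₀ * (1 + r₀) ^ 6) = tailBelow r₀ z / 25200 := by
  have ha : (1 + r₀) ≠ 0 := by positivity
  rw [tailBelow, profilePrimitive]
  field_simp
  ring

/-- Needed to merge two integrals over adjacent intervals through `ENNReal.ofReal_add`. -/
theorem sub_nonneg_of_hasDerivAt {F f : ℝ → ℝ} {a b : ℝ} (hab : a ≤ b)
    (hF : ∀ x, HasDerivAt F (f x) x) (hf : Continuous f) (h0 : ∀ x ∈ Set.Ioo a b, 0 ≤ f x) :
    0 ≤ F b - F a := by
  rw [← intervalIntegral.integral_eq_sub_of_hasDerivAt (fun x _ => hF x)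
    (hf.intervalIntegrable _ _), intervalIntegral.integral_of_le hab,
    integral_Ioc_eq_integral_Ioo]
  exact setIntegral_nonneg measurableSet_Ioo h0

theorem lintegral_Ioo_add_Ioo (f : ℝ → ENNReal) {a p b : ℝ} (hap : a ≤ p) (hpb : p ≤ b) :
    ∫⁻ x in Set.Ioo a b, f x = (∫⁻ x in Set.Ioo a p, f x) + ∫⁻ x in Set.Ioo p b, f x := by
  rw [setLIntegral_congr Ioo_ae_eq_Ioc, setLIntegral_congr (Ioo_ae_eq_Ioc (a := a) (b := p)),
    setLIntegral_congr (Ioo_ae_eq_Ioc (a := p) (b := b)), ← Set.Ioc_union_Ioc_eq_Ioc hap hpb,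
    lintegral_union measurableSet_Ioc (Set.Ioc_disjoint_Ioc_of_le le_rfl)]

theorem profile_nonneg {s w : ℝ} (hs : 0 ≤ s) (h : s + |w| ≤ 1) : 0 ≤ profile s w := by
  have hm : 0 ≤ ((1 - s) ^ 2 - w ^ 2) / 4 := by
    rw [← sq_abs w]
    nlinarith [abs_nonneg w]
  unfold profile
  positivity

/-! ### Density of the output coordinate -/

/-- The density of the output coordinate, up to a constant. -/
noncomputable def outputDensity (r₀ z : ℝ) : ENNReal :=
  ∫⁻ w, if |z - r₀ * w| + |w| < 1 then ENNReal.ofReal (profile |z - r₀ * w| w) else 0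

theorem outputDensity_eq_setLIntegral {r₀ z a b : ℝ}
    (h : ∀ w, |z - r₀ * w| + |w| < 1 ↔ w ∈ Set.Ioo a b) :
    outputDensity r₀ z = ∫⁻ w in Set.Ioo a b, ENNReal.ofReal (profile |z - r₀ * w| w) := by
  classical
  rw [outputDensity, ← lintegral_indicator measurableSet_Ioo]
  refine lintegral_congr fun w => ?_
  simp only [h, Set.indicator_apply]

theorem outputDensity_neg (r₀ z : ℝ) : outputDensity r₀ (-z) = outputDensity r₀ z := by
  rw [outputDensity, ← lintegral_neg_eq_self]
  refine lintegral_congr fun w => ?_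
  have h : |-z - r₀ * -w| = |z - r₀ * w| := by rw [← abs_neg]; congr 1; ring
  rw [h, abs_neg, profile, profile, neg_sq]

theorem outputDensity_of_one_le {r₀ z : ℝ} (h0 : 0 ≤ r₀) (h1 : r₀ ≤ 1) (hz : 1 ≤ |z|) :
    outputDensity r₀ z = 0 := by
  rw [outputDensity]
  refine (lintegral_congr fun w => if_neg ?_).trans lintegral_zero
  have h2 : |z| ≤ |z - r₀ * w| + |r₀ * w| := by
    simpa using abs_add_le (z - r₀ * w) (r₀ * w)
  rw [abs_mul, abs_of_nonneg h0] at h2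
  nlinarith [abs_nonneg w]

theorem continuous_profile_line (r₀ z : ℝ) : Continuous fun w => profile (z - r₀ * w) w := by
  unfold profile
  fun_prop

theorem outputDensity_above {r₀ z : ℝ} (h0 : 0 ≤ r₀) (hz : r₀ ≤ z) (hz1 : z < 1) :
    outputDensity r₀ z = ENNReal.ofReal (tailAbove r₀ z / 25200) := by
  have hr : 0 < 1 - r₀ := by linarith
  have hN : 0 < 1 + r₀ := by linarith
  have hdom : ∀ w, |z - r₀ * w| + |w| < 1 ↔ w ∈ Set.Ioo (-(1 - z) / (1 + r₀)) ((1 - z) / (1 - r₀)) := by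
    intro w
    rw [Set.mem_Ioo, div_lt_iff₀ hN, lt_div_iff₀ hr]
    constructor
    · intro h
      have h1 := le_abs_self (z - r₀ * w)
      have h2 := le_abs_self w
      have h3 := neg_le_abs w
      constructor <;> nlinarith
    · rintro ⟨h1, h2⟩
      rcases abs_cases (z - r₀ * w) with ⟨h, h'⟩ | ⟨h, h'⟩ <;>
        rcases abs_cases w with ⟨k, k'⟩ | ⟨k, k'⟩ <;> rw [h, k] <;> nlinarith
  have hs : ∀ w ∈ Set.Ioo (-(1 - z) / (1 + r₀)) ((1 - z) / (1 - r₀)), 0 ≤ z - r₀ * w := by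
    intro w hw
    rw [Set.mem_Ioo, div_lt_iff₀ hN, lt_div_iff₀ hr] at hw
    nlinarith [hw.1, hw.2]
  rw [outputDensity_eq_setLIntegral hdom, setLIntegral_congr_fun measurableSet_Ioo
    (fun w hw => by rw [abs_of_nonneg (hs w hw)]), lintegral_Ioo_ofReal_of_hasDerivAt ?_
    (hasDerivAt_profile hN z) (continuous_profile_line r₀ z) (fun w hw => ?_)]
  · have e1 : (1 - z + (1 + r₀) * ((1 - z) / (1 - r₀))) / 2 = (1 - z) / (1 - r₀) := by
      field_simp
      ring
    have e2 : (1 - z + (1 + r₀) * (-(1 - z) / (1 + r₀))) / 2 = 0 := by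
      field_simp
      ring
    rw [e1, e2, profilePrimitive_above h0 (by linarith)]
    simp [profilePrimitive]
  · refine le_trans (b := 0) ?_ (div_nonneg (by linarith) hr.le)
    exact div_nonpos_of_nonpos_of_nonneg (by linarith) hN.le
  · have := (hdom w).mpr hw
    rw [abs_of_nonneg (hs w hw)] at this
    exact profile_nonneg (hs w hw) this.le

theorem outputDensity_below {r₀ z : ℝ} (h1 : r₀ ≤ 1) (hz : 0 ≤ z) (hz1 : z < r₀) :
    outputDensity r₀ z = ENNReal.ofReal (tailBelow r₀ z / 25200) := by
  have h0 : 0 < r₀ := by linarith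
  have hN : 0 < 1 + r₀ := by linarith
  have hdom : ∀ w, |z - r₀ * w| + |w| < 1 ↔ w ∈ Set.Ioo (-(1 - z) / (1 + r₀)) ((1 + z) / (1 + r₀)) := by
    intro w
    rw [Set.mem_Ioo, div_lt_iff₀ hN, lt_div_iff₀ hN]
    constructor
    · intro h
      have h1 := le_abs_self (z - r₀ * w)
      have h1' := neg_le_abs (z - r₀ * w)
      have h2 := le_abs_self w
      have h3 := neg_le_abs w
      constructor <;> nlinarith
    · rintro ⟨h1, h2⟩
      rcases abs_cases (z - r₀ * w) with ⟨h, h'⟩ | ⟨h, h'⟩ <;>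
        rcases abs_cases w with ⟨k, k'⟩ | ⟨k, k'⟩ <;> rw [h, k] <;> nlinarith
  have hap : -(1 - z) / (1 + r₀) ≤ z / r₀ := by
    refine le_trans (b := 0) ?_ (div_nonneg hz h0.le)
    exact div_nonpos_of_nonpos_of_nonneg (by linarith) hN.le
  have hpb : z / r₀ ≤ (1 + z) / (1 + r₀) := by
    rw [div_le_div_iff₀ h0 hN]
    nlinarith
  have hs1 : ∀ w ∈ Set.Ioo (-(1 - z) / (1 + r₀)) (z / r₀), 0 ≤ z - r₀ * w := by
    intro w hw
    have := (lt_div_iff₀ h0).mp hw.2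
    linarith
  have hs2 : ∀ w ∈ Set.Ioo (z / r₀) ((1 + z) / (1 + r₀)), z - r₀ * w ≤ 0 := by
    intro w hw
    have := (div_lt_iff₀ h0).mp hw.1
    linarith
  -- Beyond `w = z / r₀` one has `s < 0`, so the integrand gains `s⁵/30`, with primitive `-s⁶/(180
  -- r₀)`. It vanishes at `w = z / r₀`, so the two pieces telescope there.
  have hF2 : ∀ w, HasDerivAt (fun w => 2 / (1 + r₀) ^ 6 *
      profilePrimitive (1 - z) (1 - r₀) (r₀ + z) (2 * r₀) ((1 - z + (1 + r₀) * w) / 2) -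
      (z - r₀ * w) ^ 6 / (180 * r₀)) (profile (-(z - r₀ * w)) w) w := by
    intro w
    have hl : HasDerivAt (fun w => z - r₀ * w) (-r₀) w := by
      simpa using ((hasDerivAt_id w).const_mul r₀).const_sub z
    refine ((hasDerivAt_profile hN z w).sub ((hl.pow 6).div_const (180 * r₀))).congr_deriv ?_
    rw [profile_neg]
    push_cast
    field_simp
    ring
  have hc2 : Continuous fun w => profile (-(z - r₀ * w)) w := by
    unfold profile
    fun_prop
  have hn1 : ∀ w ∈ Set.Ioo (-(1 - z) / (1 + r₀)) (z / r₀), 0 ≤ profile (z - r₀ * w) w := by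
    intro w hw
    have := (hdom w).mpr ⟨hw.1, hw.2.trans_le hpb⟩
    rw [abs_of_nonneg (hs1 w hw)] at this
    exact profile_nonneg (hs1 w hw) this.le
  have hn2 : ∀ w ∈ Set.Ioo (z / r₀) ((1 + z) / (1 + r₀)), 0 ≤ profile (-(z - r₀ * w)) w := by
    intro w hw
    have := (hdom w).mpr ⟨hap.trans_lt hw.1, hw.2⟩
    rw [abs_of_nonpos (hs2 w hw)] at this
    exact profile_nonneg (neg_nonneg.mpr (hs2 w hw)) this.le
  have hi1 : ∫⁻ w in Set.Ioo (-(1 - z) / (1 + r₀)) (z / r₀),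
      ENNReal.ofReal (profile |z - r₀ * w| w) = ∫⁻ w in Set.Ioo (-(1 - z) / (1 + r₀)) (z / r₀),
      ENNReal.ofReal (profile (z - r₀ * w) w) :=
    setLIntegral_congr_fun measurableSet_Ioo fun w hw => by rw [abs_of_nonneg (hs1 w hw)]
  have hi2 : ∫⁻ w in Set.Ioo (z / r₀) ((1 + z) / (1 + r₀)),
      ENNReal.ofReal (profile |z - r₀ * w| w) = ∫⁻ w in Set.Ioo (z / r₀) ((1 + z) / (1 + r₀)),
      ENNReal.ofReal (profile (-(z - r₀ * w)) w) :=
    setLIntegral_congr_fun measurableSet_Ioo fun w hw => by rw [abs_of_nonpos (hs2 w hw)]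
  rw [outputDensity_eq_setLIntegral hdom, lintegral_Ioo_add_Ioo _ hap hpb, hi1, hi2,
    lintegral_Ioo_ofReal_of_hasDerivAt hap (hasDerivAt_profile hN z)
      (continuous_profile_line r₀ z) hn1,
    lintegral_Ioo_ofReal_of_hasDerivAt hpb hF2 hc2 hn2,
    ← ENNReal.ofReal_add (sub_nonneg_of_hasDerivAt hap (hasDerivAt_profile hN z)
      (continuous_profile_line r₀ z) hn1) (sub_nonneg_of_hasDerivAt hpb hF2 hc2 hn2)]
  congr 1
  have e1 : (1 - z + (1 + r₀) * ((1 + z) / (1 + r₀))) / 2 = 1 := by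
    field_simp
    ring
  have e2 : (1 - z + (1 + r₀) * (-(1 - z) / (1 + r₀))) / 2 = 0 := by
    field_simp
    ring
  have e3 : z - r₀ * (z / r₀) = 0 := by
    field_simp
    ring
  have e4 : (z - r₀ * ((1 + z) / (1 + r₀))) ^ 6 / (180 * r₀) =
      (r₀ - z) ^ 6 / (180 * r₀ * (1 + r₀) ^ 6) := by
    field_simp
    ring
  have e5 : profilePrimitive (1 - z) (1 - r₀) (r₀ + z) (2 * r₀) 0 = 0 := by
    simp [profilePrimitive]
  rw [← profilePrimitive_below h0, e1, e2, e3, e4, e5]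
  ring

/-! ### Positivity and tail integrals of `kappa` -/

/-- Completing the square in `y`: `21` times the expression is `(21 y - 3 x² - 18 x)² + 6 x (x - 1)²
(2 x + 7)`. Both branches of `kappa` have this factor, with `(x, y)` equal to `(r₀, r²)` or `(r,
r₀²)`. -/
theorem kappa_factor_nonneg {x y : ℝ} (hx : 0 ≤ x) :
    0 ≤ 21 * y ^ 2 - 6 * y * x ^ 2 - 36 * y * x + x ^ 4 + 6 * x ^ 3 + 12 * x ^ 2 + 2 * x := by
  have h : 0 ≤ x * (x - 1) ^ 2 * (2 * x + 7) := by positivity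
  nlinarith [sq_nonneg (21 * y - 3 * x ^ 2 - 18 * x)]

theorem kappa_nonneg {r r₀ : ℝ} (hr : 0 ≤ r) (h0 : 0 ≤ r₀) :
    0 ≤ kappa r r₀ := by
  unfold kappa
  split_ifs with h
  · refine mul_nonneg (by positivity) ?_
    have := kappa_factor_nonneg (y := r ^ 2) h0
    nlinarith
  · refine mul_nonneg (div_nonneg (mul_nonneg (by positivity) (Even.pow_nonneg (by decide) _))
      (Even.pow_nonneg (by decide) _)) ?_
    have := kappa_factor_nonneg (y := r₀ ^ 2) hr
    nlinarith

theorem measurable_kappa (r₀ : ℝ) : Measurable fun r => kappa r r₀ := by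
  unfold kappa
  exact Measurable.ite measurableSet_Iic (by fun_prop) (by fun_prop)

theorem hasDerivAt_neg_tailAbove (r₀ r : ℝ) :
    HasDerivAt (fun r => -tailAbove r₀ r) (40 * (r - 1) ^ 6 / (1 - r₀ ^ 2) ^ 6 *
      (21 * r₀ ^ 4 - 6 * r ^ 2 * r₀ ^ 2 - 36 * r * r₀ ^ 2 + r ^ 4 + 6 * r ^ 3 + 12 * r ^ 2 +
        2 * r)) r := by
  have hl : HasDerivAt (fun r : ℝ => 1 - r) (-1) r := by
    simpa using (hasDerivAt_id r).const_sub 1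
  unfold tailAbove
  refine ((((((((hl.pow 7).const_mul (3 * (1 - r₀ ^ 2) ^ 2)).sub
    ((hl.pow 8).const_mul (6 * (1 - r₀ ^ 2)))).add ((hl.pow 9).const_mul (4 - 2 * r₀ ^ 2 / 3))).sub
    (hl.pow 10)).add ((hl.pow 11).div_const 11)).const_mul
    (40 / (1 - r₀ ^ 2) ^ 6)).neg).congr_deriv ?_
  push_cast
  rw [div_eq_mul_inv 40, div_eq_mul_inv (40 * (r - 1) ^ 6)]
  -- With the inverse as a free parameter the identity is polynomial, so it also covers `r₀ = 1`,
  -- where the denominator is `0`.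
  generalize ((1 - r₀ ^ 2) ^ 6)⁻¹ = k
  ring

theorem hasDerivAt_neg_tailBelow (r₀ r : ℝ) :
    HasDerivAt (fun r => -tailBelow r₀ r) (40 * r / (r₀ * (1 + r₀) ^ 6) *
      (21 * r ^ 4 - 6 * r ^ 2 * r₀ ^ 2 - 36 * r ^ 2 * r₀ + r₀ ^ 4 + 6 * r₀ ^ 3 + 12 * r₀ ^ 2 +
        2 * r₀)) r := by
  unfold tailBelow
  refine ((((((((hasDerivAt_pow 6 r).const_sub (r₀ ^ 6)).const_mul (7 / 2)).sub
    (((hasDerivAt_pow 4 r).const_sub (r₀ ^ 4)).const_mul ((6 * r₀ ^ 2 + 36 * r₀) / 4))).add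
    (((hasDerivAt_pow 2 r).const_sub (r₀ ^ 2)).const_mul
      ((r₀ ^ 4 + 6 * r₀ ^ 3 + 12 * r₀ ^ 2 + 2 * r₀) / 2))).const_mul
    (40 / (r₀ * (1 + r₀) ^ 6))).add_const _).neg).congr_deriv ?_
  push_cast
  rw [div_eq_mul_inv, div_eq_mul_inv (40 * r)]
  generalize (r₀ * (1 + r₀) ^ 6)⁻¹ = k
  ring

/-- The constant term of `tailBelow` is chosen to glue the two tails at `r₀`. At `r₀ = 1` both sides
are zero, on the right through division by zero. -/
theorem tailBelow_self {r₀ : ℝ} (h0 : 0 ≤ r₀) (h1 : r₀ ≤ 1) :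
    tailBelow r₀ r₀ = tailAbove r₀ r₀ := by
  rcases h1.eq_or_lt with rfl | h1
  · simp [tailBelow, tailAbove]
  · have ha : (1 + r₀) ≠ 0 := by positivity
    have hb : (1 - r₀) ≠ 0 := (sub_pos.mpr h1).ne'
    have hc : 1 - r₀ ^ 2 = (1 + r₀) * (1 - r₀) := by ring
    rw [tailBelow, tailAbove, hc]
    simp only [sub_self, mul_zero, add_zero, zero_add]
    field_simp
    ring

theorem lintegral_kappa_div_above {r₀ z : ℝ} (h0 : 0 ≤ r₀) (hz : r₀ ≤ z) (hz1 : z ≤ 1) :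
    ∫⁻ r in Set.Ioo z 1, ENNReal.ofReal (kappa r r₀ / r) = ENNReal.ofReal (tailAbove r₀ z) := by
  have hk : ∀ r ∈ Set.Ioo z 1, kappa r r₀ / r = 40 * (r - 1) ^ 6 / (1 - r₀ ^ 2) ^ 6 *
      (21 * r₀ ^ 4 - 6 * r ^ 2 * r₀ ^ 2 - 36 * r * r₀ ^ 2 + r ^ 4 + 6 * r ^ 3 + 12 * r ^ 2 +
        2 * r) := by
    intro r hr
    have hr0 : r ≠ 0 := (h0.trans_lt (hz.trans_lt hr.1)).ne'
    rw [kappa, if_neg (not_le.mpr (hz.trans_lt hr.1)), div_eq_iff hr0]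
    ring
  rw [setLIntegral_congr_fun measurableSet_Ioo (fun r hr => by rw [hk r hr]),
    lintegral_Ioo_ofReal_of_hasDerivAt hz1 (hasDerivAt_neg_tailAbove r₀) (by fun_prop)
      (fun r hr => ?_)]
  · congr 1
    simp [tailAbove]
  · rw [← hk r hr]
    have hr0 := (h0.trans_lt (hz.trans_lt hr.1)).le
    exact div_nonneg (kappa_nonneg hr0 h0) hr0

theorem lintegral_kappa_div_below {r₀ z : ℝ} (h1 : r₀ ≤ 1) (hz : 0 ≤ z) (hz1 : z < r₀) :
    ∫⁻ r in Set.Ioo z 1, ENNReal.ofReal (kappa r r₀ / r) = ENNReal.ofReal (tailBelow r₀ z) := by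
  have h0 : 0 ≤ r₀ := hz.trans hz1.le
  have hk : ∀ r ∈ Set.Ioo z r₀, kappa r r₀ / r = 40 * r / (r₀ * (1 + r₀) ^ 6) *
      (21 * r ^ 4 - 6 * r ^ 2 * r₀ ^ 2 - 36 * r ^ 2 * r₀ + r₀ ^ 4 + 6 * r₀ ^ 3 + 12 * r₀ ^ 2 +
        2 * r₀) := by
    intro r hr
    have hr0 : r ≠ 0 := (hz.trans_lt hr.1).ne'
    rw [kappa, if_pos hr.2.le, div_eq_iff hr0]
    ring
  have hn : ∀ r ∈ Set.Ioo z r₀, 0 ≤ 40 * r / (r₀ * (1 + r₀) ^ 6) *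
      (21 * r ^ 4 - 6 * r ^ 2 * r₀ ^ 2 - 36 * r ^ 2 * r₀ + r₀ ^ 4 + 6 * r₀ ^ 3 + 12 * r₀ ^ 2 +
        2 * r₀) := by
    intro r hr
    rw [← hk r hr]
    have hr0 := (hz.trans_lt hr.1).le
    exact div_nonneg (kappa_nonneg hr0 h0) hr0
  have hc : Continuous fun r : ℝ => 40 * r / (r₀ * (1 + r₀) ^ 6) *
      (21 * r ^ 4 - 6 * r ^ 2 * r₀ ^ 2 - 36 * r ^ 2 * r₀ + r₀ ^ 4 + 6 * r₀ ^ 3 + 12 * r₀ ^ 2 +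
        2 * r₀) := by fun_prop
  have ha : 0 ≤ tailAbove r₀ r₀ := by
    rw [← tailBelow_self h0 h1, tailBelow]
    have : 0 ≤ 3 * (1 + r₀) ^ 2 - 6 * (1 + r₀) + 4 - 2 * r₀ ^ 2 / 3 -
      (1 - r₀) + (1 - r₀) ^ 2 / 11 := by nlinarith
    have h2 : 0 ≤ 1 - r₀ := by linarith
    simp only [sub_self, mul_zero, add_zero, zero_add]
    positivity
  have hi : ∫⁻ r in Set.Ioo z r₀, ENNReal.ofReal (kappa r r₀ / r) =
      ENNReal.ofReal (-tailBelow r₀ r₀ - -tailBelow r₀ z) := by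
    rw [setLIntegral_congr_fun measurableSet_Ioo (fun r hr => by rw [hk r hr]),
      lintegral_Ioo_ofReal_of_hasDerivAt hz1.le (hasDerivAt_neg_tailBelow r₀) hc hn]
  rw [lintegral_Ioo_add_Ioo _ hz1.le h1, hi, lintegral_kappa_div_above h0 le_rfl h1,
    ← ENNReal.ofReal_add (sub_nonneg_of_hasDerivAt hz1.le (hasDerivAt_neg_tailBelow r₀) hc hn) ha,
    tailBelow_self h0 h1]
  congr 1
  ring

/-- The density of the output coordinate is proportional to the tail integral of `kappa r r₀ / r`. -/
theorem lintegral_kappa_div_eq_outputDensity {r₀ : ℝ} (h0 : 0 ≤ r₀) (h1 : r₀ ≤ 1) (z : ℝ) :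
    ∫⁻ r in Set.Ioo |z| 1, ENNReal.ofReal (kappa r r₀ / r) = 25200 * outputDensity r₀ z := by
  have habs : outputDensity r₀ |z| = outputDensity r₀ z := by
    rcases abs_choice z with h | h <;> rw [h]
    exact outputDensity_neg r₀ z
  have hmul : ∀ t : ℝ, (25200 : ENNReal) * ENNReal.ofReal (t / 25200) = ENNReal.ofReal t := by
    intro t
    have : (25200 : ENNReal) = ENNReal.ofReal 25200 := by simp
    rw [this, ← ENNReal.ofReal_mul (by norm_num)]
    congr 1
    ring
  rcases le_or_gt 1 |z| with h | h
  · rw [outputDensity_of_one_le h0 h1 h, Set.Ioo_eq_empty (not_lt.mpr h)]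
    simp
  rw [← habs]
  rcases le_or_gt r₀ |z| with h2 | h2
  · rw [lintegral_kappa_div_above h0 h2 h.le, outputDensity_above h0 h2 h, hmul]
  · rw [lintegral_kappa_div_below h1 (abs_nonneg z) h2, outputDensity_below h1 (abs_nonneg z) h2,
      hmul]

/-! ### Total mass of `kappa` -/

theorem hasDerivAt_massAbove (r₀ r : ℝ) :
    HasDerivAt (fun r => -(40 / (1 - r₀ ^ 2) ^ 6 * (3 * (1 - r₀ ^ 2) ^ 2 * (1 - r) ^ 7 -
      (6 * (1 - r₀ ^ 2) + 21 / 8 * (1 - r₀ ^ 2) ^ 2) * (1 - r) ^ 8 +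
      (36 - 6 * r₀ ^ 2 + 48 * (1 - r₀ ^ 2)) / 9 * (1 - r) ^ 9 -
      (46 - 6 * r₀ ^ 2) / 10 * (1 - r) ^ 10 + (1 - r) ^ 11 - (1 - r) ^ 12 / 12)))
      (40 * r * (r - 1) ^ 6 / (1 - r₀ ^ 2) ^ 6 *
      (21 * r₀ ^ 4 - 6 * r ^ 2 * r₀ ^ 2 - 36 * r * r₀ ^ 2 + r ^ 4 + 6 * r ^ 3 + 12 * r ^ 2 +
        2 * r)) r := by
  have hl : HasDerivAt (fun r : ℝ => 1 - r) (-1) r := by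
    simpa using (hasDerivAt_id r).const_sub 1
  refine (((((((((hl.pow 7).const_mul _).sub ((hl.pow 8).const_mul _)).add
    ((hl.pow 9).const_mul _)).sub ((hl.pow 10).const_mul _)).add (hl.pow 11)).sub
    ((hl.pow 12).div_const 12)).const_mul _).neg).congr_deriv ?_
  push_cast
  rw [div_eq_mul_inv, div_eq_mul_inv (40 * r * _)]
  generalize ((1 - r₀ ^ 2) ^ 6)⁻¹ = k
  ring

theorem hasDerivAt_massBelow (r₀ r : ℝ) :
    HasDerivAt (fun r => 40 / (r₀ * (1 + r₀) ^ 6) * (3 * r ^ 7 -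
      (6 * r₀ ^ 2 + 36 * r₀) / 5 * r ^ 5 +
      (r₀ ^ 4 + 6 * r₀ ^ 3 + 12 * r₀ ^ 2 + 2 * r₀) / 3 * r ^ 3))
      (40 * r ^ 2 / (r₀ * (1 + r₀) ^ 6) *
      (21 * r ^ 4 - 6 * r ^ 2 * r₀ ^ 2 - 36 * r ^ 2 * r₀ + r₀ ^ 4 + 6 * r₀ ^ 3 + 12 * r₀ ^ 2 +
        2 * r₀)) r := by
  refine (((((hasDerivAt_pow 7 r).const_mul 3).sub ((hasDerivAt_pow 5 r).const_mul _)).add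
    ((hasDerivAt_pow 3 r).const_mul _)).const_mul _).congr_deriv ?_
  push_cast
  rw [div_eq_mul_inv, div_eq_mul_inv (40 * r ^ 2)]
  generalize (r₀ * (1 + r₀) ^ 6)⁻¹ = k
  ring

theorem lintegral_kappa {r₀ : ℝ} (h0 : 0 ≤ r₀) (h1 : r₀ ≤ 1) :
    ∫⁻ r in Set.Ioo 0 1, ENNReal.ofReal (kappa r r₀) = 1 := by
  have hk1 : ∀ r ∈ Set.Ioo 0 r₀, kappa r r₀ = 40 * r ^ 2 / (r₀ * (1 + r₀) ^ 6) *
      (21 * r ^ 4 - 6 * r ^ 2 * r₀ ^ 2 - 36 * r ^ 2 * r₀ + r₀ ^ 4 + 6 * r₀ ^ 3 + 12 * r₀ ^ 2 +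
        2 * r₀) := fun r hr => by rw [kappa, if_pos hr.2.le]
  have hk2 : ∀ r ∈ Set.Ioo r₀ 1, kappa r r₀ = 40 * r * (r - 1) ^ 6 / (1 - r₀ ^ 2) ^ 6 *
      (21 * r₀ ^ 4 - 6 * r ^ 2 * r₀ ^ 2 - 36 * r * r₀ ^ 2 + r ^ 4 + 6 * r ^ 3 + 12 * r ^ 2 +
        2 * r) := fun r hr => by rw [kappa, if_neg (not_le.mpr hr.1)]
  have hn1 : ∀ r ∈ Set.Ioo 0 r₀, 0 ≤ 40 * r ^ 2 / (r₀ * (1 + r₀) ^ 6) *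
      (21 * r ^ 4 - 6 * r ^ 2 * r₀ ^ 2 - 36 * r ^ 2 * r₀ + r₀ ^ 4 + 6 * r₀ ^ 3 + 12 * r₀ ^ 2 +
        2 * r₀) := fun r hr => by
    rw [← hk1 r hr]; exact kappa_nonneg hr.1.le h0
  have hn2 : ∀ r ∈ Set.Ioo r₀ 1, 0 ≤ 40 * r * (r - 1) ^ 6 / (1 - r₀ ^ 2) ^ 6 *
      (21 * r₀ ^ 4 - 6 * r ^ 2 * r₀ ^ 2 - 36 * r * r₀ ^ 2 + r ^ 4 + 6 * r ^ 3 + 12 * r ^ 2 +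
        2 * r) := fun r hr => by
    rw [← hk2 r hr]; exact kappa_nonneg (h0.trans hr.1.le) h0
  have hc1 : Continuous fun r : ℝ => 40 * r ^ 2 / (r₀ * (1 + r₀) ^ 6) *
      (21 * r ^ 4 - 6 * r ^ 2 * r₀ ^ 2 - 36 * r ^ 2 * r₀ + r₀ ^ 4 + 6 * r₀ ^ 3 + 12 * r₀ ^ 2 +
        2 * r₀) := by fun_prop
  have hc2 : Continuous fun r : ℝ => 40 * r * (r - 1) ^ 6 / (1 - r₀ ^ 2) ^ 6 *
      (21 * r₀ ^ 4 - 6 * r ^ 2 * r₀ ^ 2 - 36 * r * r₀ ^ 2 + r ^ 4 + 6 * r ^ 3 + 12 * r ^ 2 +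
        2 * r) := by fun_prop
  rw [lintegral_Ioo_add_Ioo _ h0 h1,
    setLIntegral_congr_fun (g := fun r => ENNReal.ofReal (40 * r ^ 2 / (r₀ * (1 + r₀) ^ 6) *
      (21 * r ^ 4 - 6 * r ^ 2 * r₀ ^ 2 - 36 * r ^ 2 * r₀ + r₀ ^ 4 + 6 * r₀ ^ 3 + 12 * r₀ ^ 2 +
        2 * r₀))) measurableSet_Ioo (fun r hr => by rw [hk1 r hr]),
    setLIntegral_congr_fun (s := Set.Ioo r₀ 1) measurableSet_Ioo (fun r hr => by rw [hk2 r hr]),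
    lintegral_Ioo_ofReal_of_hasDerivAt h0 (hasDerivAt_massBelow r₀) hc1 hn1,
    lintegral_Ioo_ofReal_of_hasDerivAt h1 (hasDerivAt_massAbove r₀) hc2 hn2,
    ← ENNReal.ofReal_add (sub_nonneg_of_hasDerivAt h0 (hasDerivAt_massBelow r₀) hc1 hn1)
      (sub_nonneg_of_hasDerivAt h1 (hasDerivAt_massAbove r₀) hc2 hn2), ENNReal.ofReal_eq_one]
  -- At `r₀ = 1` and `r₀ = 0` one branch has a vanishing denominator, but then it is integrated over
  -- an empty interval.
  rcases h1.eq_or_lt with rfl | h1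
  · norm_num
  have hb : (1 - r₀) ≠ 0 := (sub_pos.mpr h1).ne'
  have hc : 1 - r₀ ^ 2 = (1 + r₀) * (1 - r₀) := by ring
  have ha : (1 + r₀) ≠ 0 := by positivity
  rcases h0.eq_or_lt with rfl | h0
  · norm_num
  · rw [hc]
    field_simp
    ring

/-! ### Radial measures and their marginals -/

theorem lintegral_fun_norm_addHaar {E : Type*} [NormedAddCommGroup E] [NormedSpace ℝ E]
    [FiniteDimensional ℝ E] [Nontrivial E] [MeasurableSpace E] [BorelSpace E] (μ : Measure E)
    [μ.IsAddHaarMeasure] {f : ℝ → ENNReal} (hf : Measurable f) :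
    ∫⁻ x, f ‖x‖ ∂μ = μ.toSphere Set.univ *
      ∫⁻ r in Set.Ioi (0 : ℝ), ENNReal.ofReal (r ^ (Module.finrank ℝ E - 1)) * f r := by
  have hm : Measurable fun r : Set.Ioi (0 : ℝ) => f r := hf.comp measurable_subtype_coe
  calc
    ∫⁻ x, f ‖x‖ ∂μ = ∫⁻ x in ({0}ᶜ : Set E), f ‖x‖ ∂μ := by
      rw [restrict_compl_singleton]
    _ = ∫⁻ x : ({(0)}ᶜ : Set E), f ‖x.1‖ ∂(μ.comap (↑)) :=
      (lintegral_subtype_comap (measurableSet_singleton _).compl fun x => f ‖x‖).symm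
    _ = ∫⁻ x, f x.2 ∂(μ.toSphere.prod (.volumeIoiPow (Module.finrank ℝ E - 1))) :=
      by simpa using μ.measurePreserving_homeomorphUnitSphereProd.lintegral_comp
          (f := fun x => f x.2) (hm.comp measurable_snd)
    _ = μ.toSphere Set.univ * ∫⁻ r, f r ∂(.volumeIoiPow (Module.finrank ℝ E - 1)) := by
      rw [lintegral_prod (fun x : Metric.sphere (0 : E) 1 × Set.Ioi (0 : ℝ) => f x.2)
        (hm.comp measurable_snd).aemeasurable]
      simp [mul_comm]
    _ = _ := by
      rw [Measure.volumeIoiPow, lintegral_withDensity_eq_lintegral_mul _ (by fun_prop) hm]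
      congr 1
      exact lintegral_subtype_comap measurableSet_Ioi
        fun r => ENNReal.ofReal (r ^ (Module.finrank ℝ E - 1)) * f r

/-- Substituting `r² = z² + ‖c‖²` in a planar slice turns the area element into `2 π r dr`, with `r`
starting at `|z|`. -/
theorem lintegral_comp_sqrt_sq_add {g : ℝ → ENNReal} (hg : Measurable g) (z : ℝ) :
    ∫⁻ c : ℂ, g √(z ^ 2 + ‖c‖ ^ 2) =
      ENNReal.ofReal Real.pi * ∫⁻ r in Set.Ioi |z|, ENNReal.ofReal (2 * r) * g r := by
  rw [Complex.lintegral_comp_norm_sq (F := fun u => g √(z ^ 2 + u)) (by fun_prop)]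
  congr 1
  calc
    ∫⁻ u in Set.Ioi 0, g √(z ^ 2 + u) =
        ∫⁻ u, (Set.Ioi (z ^ 2)).indicator (fun v => g √v) (z ^ 2 + u) := by
      rw [← lintegral_indicator measurableSet_Ioi]
      congr 1 with u
      simp [Set.indicator_apply]
    _ = ∫⁻ u in Set.Ioi 0, (Set.Ioi (z ^ 2)).indicator (fun v => g √v) u := by
      rw [lintegral_add_left_eq_self, ← lintegral_indicator measurableSet_Ioi,
        Set.indicator_indicator, Set.inter_eq_right.mpr (Set.Ioi_subset_Ioi (sq_nonneg z))]
    _ = ∫⁻ r in Set.Ioi 0, ENNReal.ofReal (2 * r) *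
        (Set.Ioi (z ^ 2)).indicator (fun v => g √v) (r ^ 2) :=
      (lintegral_comp_sq_Ioi _).symm
    _ = ∫⁻ r in Set.Ioi |z|, ENNReal.ofReal (2 * r) * g r := by
      rw [← lintegral_indicator measurableSet_Ioi, ← lintegral_indicator measurableSet_Ioi]
      congr 1 with r
      by_cases hr : 0 < r
      · have : r ^ 2 ∈ Set.Ioi (z ^ 2) ↔ r ∈ Set.Ioi |z| := by
          rw [Set.mem_Ioi, Set.mem_Ioi, sq_lt_sq, abs_of_pos hr]
        by_cases h : r ∈ Set.Ioi |z|
        · rw [Set.indicator_of_mem h, Set.indicator_of_mem (Set.mem_Ioi.mpr hr),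
            Set.indicator_of_mem (this.mpr h), Real.sqrt_sq hr.le]
        · rw [Set.indicator_of_notMem h, Set.indicator_of_mem (Set.mem_Ioi.mpr hr),
            Set.indicator_of_notMem (fun h' => h (this.mp h')), mul_zero]
      · rw [Set.indicator_of_notMem (Set.notMem_Ioi.mpr (not_lt.mp hr)), Set.indicator_of_notMem]
        exact fun h => hr ((abs_nonneg z).trans_lt h)

/-- Cylindrical coordinates on `ℝ³`, with the last coordinate along the axis. -/
noncomputable def cylindricalEquiv : (ℝ × ℂ) ≃ₗ[ℝ] EuclideanSpace ℝ (Fin 3) where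
  toFun p := !₂[p.2.re, p.2.im, p.1]
  invFun v := (v 2, ⟨v 0, v 1⟩)
  map_add' p q := by ext i; fin_cases i <;> simp
  map_smul' a p := by ext i; fin_cases i <;> simp
  left_inv p := by simp
  right_inv v := by ext i; fin_cases i <;> simp

theorem cylindricalEquiv_apply_two (p : ℝ × ℂ) : cylindricalEquiv p 2 = p.1 := rfl

theorem norm_cylindricalEquiv (p : ℝ × ℂ) :
    ‖cylindricalEquiv p‖ = √(p.1 ^ 2 + ‖p.2‖ ^ 2) := by
  rw [EuclideanSpace.norm_eq, Fin.sum_univ_three, ← Complex.normSq_eq_norm_sq, Complex.normSq_apply]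
  simp only [Real.norm_eq_abs, sq_abs]
  congr 1
  change p.2.re ^ 2 + p.2.im ^ 2 + p.1 ^ 2 = _
  ring

/-- The law of the last coordinate under a radial density on `ℝ³`. -/
theorem exists_lintegral_coord_mul_comp_norm_eq :
    ∃ C : ENNReal, C ≠ 0 ∧ C ≠ ⊤ ∧ ∀ φ g : ℝ → ENNReal, Measurable φ → Measurable g →
      ∫⁻ v : EuclideanSpace ℝ (Fin 3), φ (v 2) * g ‖v‖ =
        C * ∫⁻ z, φ z * ∫⁻ r in Set.Ioi |z|, ENNReal.ofReal (2 * r) * g r := by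
  obtain ⟨c, hc0, hc, h⟩ := exists_map_affine_eq_smul (volume : Measure (ℝ × ℂ))
    (volume : Measure (EuclideanSpace ℝ (Fin 3))) cylindricalEquiv 0
  simp only [add_zero] at h
  have hL : Measurable cylindricalEquiv :=
    cylindricalEquiv.toLinearMap.continuous_of_finiteDimensional.measurable
  refine ⟨c⁻¹ * ENNReal.ofReal Real.pi, mul_ne_zero (ENNReal.inv_ne_zero.mpr hc)
    (by simpa using Real.pi_pos), ENNReal.mul_ne_top (ENNReal.inv_ne_top.mpr hc0)
    ENNReal.ofReal_ne_top, fun φ g hφ hg => ?_⟩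
  have hm : Measurable fun v : EuclideanSpace ℝ (Fin 3) => φ (v 2) * g ‖v‖ := by fun_prop
  have h1 : c * ∫⁻ v : EuclideanSpace ℝ (Fin 3), φ (v 2) * g ‖v‖ =
      ∫⁻ z, φ z * (ENNReal.ofReal Real.pi *
        ∫⁻ r in Set.Ioi |z|, ENNReal.ofReal (2 * r) * g r) := by
    rw [← smul_eq_mul, ← lintegral_smul_measure, ← h, lintegral_map hm hL, Measure.volume_eq_prod,
      lintegral_prod (fun p => φ (cylindricalEquiv p 2) * g ‖cylindricalEquiv p‖)
        (hm.comp hL).aemeasurable]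
    congr 1 with z
    simp only [cylindricalEquiv_apply_two, norm_cylindricalEquiv]
    rw [lintegral_const_mul _ (by fun_prop), lintegral_comp_sqrt_sq_add hg]
  rw [← ENNReal.mul_right_inj hc0 hc, h1, ← mul_assoc, ← mul_assoc, ENNReal.mul_inv_cancel hc0 hc,
    one_mul, ← lintegral_const_mul' _ _ ENNReal.ofReal_ne_top]
  congr 1 with z
  ring

theorem LinearIsometryEquiv.measurePreserving_withDensity_comp_norm {E : Type*}
    [NormedAddCommGroup E] [InnerProductSpace ℝ E] [FiniteDimensional ℝ E] [MeasurableSpace E]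
    [BorelSpace E] (R : E ≃ₗᵢ[ℝ] E) {g : ℝ → ENNReal} (hg : Measurable g) :
    MeasurePreserving R ((volume : Measure E).withDensity fun v => g ‖v‖)
      ((volume : Measure E).withDensity fun v => g ‖v‖) := by
  have hR := R.measurePreserving
  refine ⟨hR.measurable, ?_⟩
  ext s hs
  rw [Measure.map_apply hR.measurable hs, withDensity_apply _ (hR.measurable hs),
    withDensity_apply _ hs, ← hR.setLIntegral_comp_preimage hs (by fun_prop)]
  simp

/-- The characteristic function of a radial measure is determined by any of its marginals. -/
theorem charFun_withDensity_comp_norm {E : Type*} [NormedAddCommGroup E] [InnerProductSpace ℝ E]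
    [FiniteDimensional ℝ E] [MeasurableSpace E] [BorelSpace E] {g : ℝ → ENNReal}
    (hg : Measurable g) {e : E} (he : ‖e‖ = 1) (t : E) :
    charFun ((volume : Measure E).withDensity fun v => g ‖v‖) t =
      charFun (((volume : Measure E).withDensity fun v => g ‖v‖).map fun v => inner ℝ v e) ‖t‖ := by
  set ν := (volume : Measure E).withDensity fun v => g ‖v‖
  have h : ‖t‖ = ‖‖t‖ • e‖ := by rw [norm_smul, he, mul_one, norm_norm]
  -- The reflection exchanging `‖t‖ • e` and `t` preserves the radial measure, which reduces the
  -- direction of `t` to `e`.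
  set R := (ℝ ∙ (‖t‖ • e - t))ᗮ.reflection
  have hR : R (‖t‖ • e) = t := Submodule.reflection_sub h.symm
  rw [charFun_apply, charFun_apply_real, integral_map (by fun_prop) (by fun_prop),
    ← (R.measurePreserving_withDensity_comp_norm hg).integral_comp
      R.toHomeomorph.measurableEmbedding]
  congr 1 with v
  have : inner ℝ (R v) t = ‖t‖ * inner ℝ v e := by
    conv_lhs => rw [← hR, R.inner_map_map, inner_smul_right]
  rw [this]
  push_cast
  rfl

/-! ### The candidate law on the Bloch ball -/

/-- The density of the output Bloch vector at radius `r`, up to normalization. -/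
noncomputable def blochDensity (r₀ : ℝ) : ℝ → ENNReal :=
  (Set.Ioo 0 1).indicator fun r => ENNReal.ofReal (kappa r r₀ / r ^ 2)

theorem measurable_blochDensity (r₀ : ℝ) : Measurable (blochDensity r₀) :=
  Measurable.indicator ((measurable_kappa r₀).div (by fun_prop)).ennreal_ofReal measurableSet_Ioo

theorem lintegral_mul_blochDensity {r₀ : ℝ} (h0 : 0 ≤ r₀) (h1 : r₀ ≤ 1) (z : ℝ) :
    ∫⁻ r in Set.Ioi |z|, ENNReal.ofReal (2 * r) * blochDensity r₀ r =
      50400 * outputDensity r₀ z := by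
  have h : (50400 : ENNReal) = 2 * 25200 := by norm_num
  rw [h, mul_assoc, ← lintegral_kappa_div_eq_outputDensity h0 h1,
    ← lintegral_const_mul' _ _ ENNReal.ofNat_ne_top,
    ← lintegral_indicator measurableSet_Ioi, ← lintegral_indicator measurableSet_Ioo]
  congr 1 with r
  by_cases hr : r ∈ Set.Ioo |z| 1
  · have hr0 : 0 < r := (abs_nonneg z).trans_lt hr.1
    rw [Set.indicator_of_mem hr, Set.indicator_of_mem (Set.mem_Ioi.mpr hr.1), blochDensity,
      Set.indicator_of_mem (Set.mem_Ioo.mpr ⟨hr0, hr.2⟩), ← ENNReal.ofReal_mul (by positivity),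
      ← ENNReal.ofReal_ofNat 2, ← ENNReal.ofReal_mul zero_le_two]
    congr 1
    field_simp
  · rw [Set.indicator_of_notMem hr]
    by_cases hz : r ∈ Set.Ioi |z|
    · rw [Set.indicator_of_mem hz, blochDensity,
        Set.indicator_of_notMem fun h => hr ⟨hz, h.2⟩, mul_zero]
    · rw [Set.indicator_of_notMem hz]

/-- The rotation invariant measure on the Bloch ball which is proportional to the law of the
output Bloch vector. -/
noncomputable def blochMeasure (r₀ : ℝ) : Measure (EuclideanSpace ℝ (Fin 3)) :=
  volume.withDensity fun v => blochDensity r₀ ‖v‖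

/-- The factor `r²` of polar coordinates cancels the denominator of `blochDensity`, leaving `kappa`.
-/
theorem map_norm_blochMeasure (r₀ : ℝ) :
    (blochMeasure r₀).map (fun v => ‖v‖) =
      (volume : Measure (EuclideanSpace ℝ (Fin 3))).toSphere Set.univ •
        (volume.restrict (Set.Ioc (0 : ℝ) 1)).withDensity
          fun r => ENNReal.ofReal (kappa r r₀) := by
  have hg := measurable_blochDensity r₀
  ext s hs
  have hns : MeasurableSet ((fun v : EuclideanSpace ℝ (Fin 3) => ‖v‖) ⁻¹' s) := measurable_norm hs
  rw [Measure.map_apply measurable_norm hs, blochMeasure, withDensity_apply _ hns,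
    Measure.smul_apply, smul_eq_mul, withDensity_apply _ hs, ← lintegral_indicator hns]
  have h := lintegral_fun_norm_addHaar (volume : Measure (EuclideanSpace ℝ (Fin 3)))
    (hg.indicator hs)
  refine Eq.trans h ?_
  congr 1
  rw [Measure.restrict_congr_set Ioo_ae_eq_Ioc.symm, finrank_euclideanSpace_fin,
    ← lintegral_indicator hs, ← lintegral_indicator measurableSet_Ioi,
    ← lintegral_indicator measurableSet_Ioo]
  congr 1 with r
  by_cases hr : r ∈ Set.Ioo 0 1
  · rw [Set.indicator_of_mem hr, Set.indicator_of_mem (Set.mem_Ioi.mpr hr.1)]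
    by_cases hrs : r ∈ s
    · have := hr.1.ne'
      rw [Set.indicator_of_mem hrs, Set.indicator_of_mem hrs, blochDensity,
        Set.indicator_of_mem hr, ← ENNReal.ofReal_mul (pow_nonneg hr.1.le _)]
      congr 1
      field_simp
      norm_num [mul_comm]
    · rw [Set.indicator_of_notMem hrs, Set.indicator_of_notMem hrs, mul_zero]
  · rw [Set.indicator_of_notMem hr]
    by_cases hz : r ∈ Set.Ioi 0
    · rw [Set.indicator_of_mem hz, blochDensity, Set.indicator_indicator,
        Set.indicator_of_notMem fun h => hr h.2, mul_zero]
    · rw [Set.indicator_of_notMem hz]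

theorem withDensity_kappa_univ {r₀ : ℝ} (h0 : 0 ≤ r₀) (h1 : r₀ ≤ 1) :
    (volume.restrict (Set.Ioc (0 : ℝ) 1)).withDensity
      (fun r => ENNReal.ofReal (kappa r r₀)) Set.univ = 1 := by
  rw [withDensity_apply _ MeasurableSet.univ, Measure.restrict_univ,
    Measure.restrict_congr_set Ioo_ae_eq_Ioc.symm, lintegral_kappa h0 h1]

theorem blochMeasure_univ {r₀ : ℝ} (h0 : 0 ≤ r₀) (h1 : r₀ ≤ 1) :
    blochMeasure r₀ Set.univ =
      (volume : Measure (EuclideanSpace ℝ (Fin 3))).toSphere Set.univ := by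
  rw [← Set.preimage_univ (f := fun v : EuclideanSpace ℝ (Fin 3) => ‖v‖),
    ← Measure.map_apply measurable_norm MeasurableSet.univ, map_norm_blochMeasure,
    Measure.smul_apply, withDensity_kappa_univ h0 h1, smul_eq_mul, mul_one]

/-- The output coordinate is distributed like the last coordinate of the Bloch measure. -/
theorem exists_map_outputCoord_eq_smul {r₀ : ℝ} (h0 : 0 ≤ r₀) (h1 : r₀ ≤ 1) :
    ∃ C : ENNReal, C ≠ 0 ∧ C ≠ ⊤ ∧
      (volume.restrict (Set.range QubitChannel.coords)).map (outputCoord r₀) =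
        C • (blochMeasure r₀).map fun v => v 2 := by
  obtain ⟨A, hA0, hA, h⟩ := exists_lintegral_range_coords_eq r₀
  obtain ⟨B, hB0, hB, h'⟩ := exists_lintegral_coord_mul_comp_norm_eq
  have hm : Measurable (outputCoord r₀) := by unfold outputCoord; fun_prop
  have hpi : ENNReal.ofReal Real.pi ≠ 0 := by simpa using Real.pi_pos
  have hB' : B * 50400 ≠ 0 := mul_ne_zero hB0 (by norm_num)
  have hB'' : B * 50400 ≠ ⊤ := ENNReal.mul_ne_top hB (by norm_num)
  refine ⟨A * ENNReal.ofReal Real.pi * (B * 50400)⁻¹,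
    mul_ne_zero (mul_ne_zero hA0 hpi) (ENNReal.inv_ne_zero.mpr hB''),
    ENNReal.mul_ne_top (ENNReal.mul_ne_top hA ENNReal.ofReal_ne_top)
      (ENNReal.inv_ne_top.mpr hB'), ?_⟩
  have hv : Measurable fun v : EuclideanSpace ℝ (Fin 3) => v 2 := by fun_prop
  ext s hs
  have hφ : Measurable (s.indicator (1 : ℝ → ENNReal)) := measurable_one.indicator hs
  -- Both laws have density `outputDensity r₀` up to the constants `A π` and `50400 B`.
  have e1 : (volume.restrict (Set.range QubitChannel.coords)).map (outputCoord r₀) s =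
      A * ENNReal.ofReal Real.pi * ∫⁻ z, s.indicator 1 z * outputDensity r₀ z := by
    rw [← lintegral_indicator_one hs, lintegral_map hφ hm, h _ hφ, mul_assoc,
      ← lintegral_const_mul' _ _ ENNReal.ofReal_ne_top]
    congr 2 with z
    simp only [lintegral_blockDensity]
    rw [lintegral_const_mul' _ _ ENNReal.ofReal_ne_top, outputDensity]
    ring
  have e2 : (blochMeasure r₀).map (fun v => v 2) s =
      B * 50400 * ∫⁻ z, s.indicator 1 z * outputDensity r₀ z := by
    rw [← lintegral_indicator_one hs, lintegral_map hφ hv, blochMeasure]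
    refine (lintegral_withDensity_eq_lintegral_mul _
      ((measurable_blochDensity r₀).comp measurable_norm) (hφ.comp hv)).trans ?_
    simp only [Pi.mul_apply, Function.comp_apply, mul_comm (blochDensity r₀ _)]
    rw [h' _ _ hφ (measurable_blochDensity r₀), mul_assoc,
      ← lintegral_const_mul' 50400 _ ENNReal.ofNat_ne_top]
    congr 2 with z
    rw [lintegral_mul_blochDensity h0 h1]
    ring
  rw [Measure.smul_apply, e1, e2, smul_eq_mul, mul_assoc _ (B * 50400)⁻¹, ← mul_assoc (B * 50400)⁻¹,
    ENNReal.inv_mul_cancel hB' hB'', one_mul]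

/-- The total mass can be read off the output coordinate at `r₀ = 0`. That computation does not use
unitary invariance, so invariance may in turn rely on this result. -/
theorem volume_range_coords_ne_zero : volume (Set.range QubitChannel.coords) ≠ 0 ∧
    volume (Set.range QubitChannel.coords) ≠ ⊤ := by
  obtain ⟨C, hC0, hC, h⟩ := exists_map_outputCoord_eq_smul le_rfl zero_le_one
  have hm : Measurable (outputCoord 0) := by unfold outputCoord; fun_prop
  have := congrArg (fun μ => μ Set.univ) h
  simp only [Measure.smul_apply, smul_eq_mul] at this
  rw [Measure.map_apply hm MeasurableSet.univ, Measure.map_apply (by fun_prop) MeasurableSet.univ,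
    Set.preimage_univ, Set.preimage_univ, Measure.restrict_apply_univ,
    blochMeasure_univ le_rfl zero_le_one] at this
  rw [this]
  exact ⟨mul_ne_zero hC0 (Measure.measure_univ_ne_zero.mpr (Measure.toSphere_ne_zero _)),
    ENNReal.mul_ne_top hC (measure_ne_top _ _)⟩

/-! ### From marginals to the law of the output state -/

theorem IsQubitState.exists_eq_unitary_conj {ρ : Mat2} (hρ : IsQubitState ρ) :
    ∃ U ∈ Matrix.unitaryGroup (Fin 2) ℂ, ρ = U *
      !![((1 + blochRadius ρ) / 2 : ℂ), 0; 0, ((1 - blochRadius ρ) / 2 : ℂ)] *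
        U.conjTranspose := by
  obtain ⟨U, hU, h⟩ := exists_unitary_sum_smul_pauli (blochVector ρ)
  refine ⟨U, hU, ?_⟩
  have h1 : U * U.conjTranspose = 1 := Matrix.mem_unitaryGroup_iff.mp hU
  have hd : !![((1 + blochRadius ρ) / 2 : ℂ), 0; 0, ((1 - blochRadius ρ) / 2 : ℂ)] =
      (1 / 2 : ℂ) • (1 + (blochRadius ρ : ℂ) • pauli 2) := by
    ext i j
    fin_cases i <;> fin_cases j <;> simp [pauli] <;> ring
  rw [hd, Matrix.mul_smul, Matrix.smul_mul, mul_add, add_mul, mul_one, h1, Matrix.mul_smul,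
    Matrix.smul_mul, blochRadius, ← h]
  exact (stokes_blochVector hρ).symm

theorem IsQubitState.blochRadius_le_one {ρ : Mat2} (hρ : IsQubitState ρ) : blochRadius ρ ≤ 1 := by
  obtain ⟨U, hU, h⟩ := hρ.exists_eq_unitary_conj
  have h1 : U.conjTranspose * U = 1 := Matrix.mem_unitaryGroup_iff'.mp hU
  have hp := hρ.1.conjTranspose_mul_mul_same U
  set D : Mat2 := !![((1 + blochRadius ρ) / 2 : ℂ), 0; 0, ((1 - blochRadius ρ) / 2 : ℂ)] with hD
  have hc : U.conjTranspose * ρ * U = D := by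
    rw [h, ← mul_assoc, ← mul_assoc, h1, one_mul, mul_assoc, h1, mul_one]
  rw [hc] at hp
  have := (Complex.le_def.mp (hp.diag_nonneg (i := 1))).1
  simp [hD] at this
  linarith

theorem trace_linOf_diagonal_mul_pauli (r₀ : ℝ) (x : ℝ × ℝ × ℂ × ℂ × ℂ × ℂ × ℂ) :
    (linOf x !![((1 + r₀) / 2 : ℂ), 0; 0, ((1 - r₀) / 2 : ℂ)] * pauli 2).trace.re =
      outputCoord r₀ x := by
  simp [linOf, pauli, outputCoord, Matrix.trace, Fin.sum_univ_two]
  ring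

/-- Every marginal of the output Bloch vector is an output coordinate of a unitarily
conjugated channel. -/
theorem exists_inner_blochVector_linOf_eq {ρ : Mat2} (hρ : IsQubitState ρ)
    (t : EuclideanSpace ℝ (Fin 3)) :
    ∃ U ∈ Matrix.unitaryGroup (Fin 2) ℂ, ∃ W ∈ Matrix.unitaryGroup (Fin 2) ℂ, ∀ x,
      inner ℝ (blochVector (linOf x ρ)) t =
        outputCoord (blochRadius ρ) (conjCoords U W x) * ‖t‖ := by
  obtain ⟨U, hU, h⟩ := hρ.exists_eq_unitary_conj
  obtain ⟨W, hW, h'⟩ := exists_unitary_sum_smul_pauli t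
  have hW' : W.conjTranspose ∈ Matrix.unitaryGroup (Fin 2) ℂ := Unitary.star_mem hW
  refine ⟨U, hU, W.conjTranspose, hW', fun x => ?_⟩
  -- `U` diagonalizes the input state, and cyclicity of the trace moves the unitary `W` that aligns
  -- `t` with the third axis onto the output of the map.
  rw [← trace_linOf_diagonal_mul_pauli, linOf_conjCoords hU hW', conjMap_apply,
    ← h, Matrix.conjTranspose_conjTranspose, blochVector_inner, h', Matrix.mul_smul,
    Matrix.trace_smul, smul_eq_mul, Complex.re_ofReal_mul, mul_comm, mul_assoc _ W,
    mul_assoc W.conjTranspose, Matrix.trace_mul_comm W.conjTranspose]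
  simp only [mul_assoc]

theorem continuous_blochVector : Continuous blochVector := by
  unfold blochVector
  fun_prop

/-- The law of the output Bloch vector. -/
theorem exists_map_blochVector_linOf_eq_smul {ρ : Mat2} (hρ : IsQubitState ρ) :
    ∃ C : ENNReal, (volume.restrict (Set.range QubitChannel.coords)).map
      (fun x => blochVector (linOf x ρ)) = C • blochMeasure (blochRadius ρ) := by
  obtain ⟨hR0, hR⟩ := volume_range_coords_ne_zero
  have h0 : 0 ≤ blochRadius ρ := norm_nonneg _
  obtain ⟨C, -, hC, h⟩ := exists_map_outputCoord_eq_smul h0 hρ.blochRadius_le_one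
  have hm : Measurable (outputCoord (blochRadius ρ)) := by unfold outputCoord; fun_prop
  have hX : Measurable fun x => blochVector (linOf x ρ) :=
    (continuous_blochVector.comp (continuous_linOf_apply ρ)).measurable
  have : IsFiniteMeasure (volume.restrict (Set.range QubitChannel.coords)) :=
    isFiniteMeasure_restrict.mpr hR
  have : IsFiniteMeasure (blochMeasure (blochRadius ρ)) := ⟨by
    rw [blochMeasure_univ h0 hρ.blochRadius_le_one]
    exact measure_lt_top _ _⟩
  have : IsFiniteMeasure (C • blochMeasure (blochRadius ρ)) := Measure.smul_finite _ hC
  refine ⟨C, Measure.ext_of_charFun (funext fun t => ?_)⟩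
  obtain ⟨U, hU, W, hW, hin⟩ := exists_inner_blochVector_linOf_eq hρ t
  have hconj := measurePreserving_conjCoords hU hW hR0 hR
  have he : (fun v : EuclideanSpace ℝ (Fin 3) => v 2) =
      fun v => inner ℝ v (EuclideanSpace.single 2 1) := by
    ext v
    simp [EuclideanSpace.inner_single_right]
  -- Invariance under `conjCoords U W` reduces the characteristic function at `t` to that of the
  -- output coordinate at `‖t‖`; the radial measure has the same reduction to its last coordinate.
  calc
    charFun _ t = charFun ((volume.restrict (Set.range QubitChannel.coords)).map
        (outputCoord (blochRadius ρ))) ‖t‖ := by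
      rw [charFun_apply, charFun_apply_real, integral_map hX.aemeasurable (by fun_prop),
        ← hconj.map_eq, Measure.map_map hm hconj.measurable,
        integral_map (hm.comp hconj.measurable).aemeasurable (by fun_prop), hconj.map_eq]
      congr 1 with x
      rw [hin]
      simp [mul_comm]
    _ = charFun (C • blochMeasure (blochRadius ρ)) t := by
      rw [h, charFun_apply_real, charFun_apply, integral_smul_measure, integral_smul_measure,
        ← charFun_apply_real, ← charFun_apply, he, blochMeasure,
        charFun_withDensity_comp_norm (measurable_blochDensity _)
          (e := EuclideanSpace.single 2 1) (by simp) t]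

theorem mainTheorem5 {Ω : Type*} [MeasurableSpace Ω] (P : Measure Ω) [IsProbabilityMeasure P]
    (Φ : Ω → QubitChannel) (hΦ : QubitChannel.IsUniform Φ P)
    (ρ : Mat2) (hρ : IsQubitState ρ) (r₀ : ℝ) (hr₀ : blochRadius ρ = r₀) :
    (∀ r ∈ Set.Ioc (0 : ℝ) 1, 0 ≤ kappa r r₀) ∧
      P.map (fun ω => blochRadius ((Φ ω).toLinearMap ρ)) =
        (volume.restrict (Set.Ioc (0 : ℝ) 1)).withDensity
          (fun r => ENNReal.ofReal (kappa r r₀)) := by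
  subst hr₀
  have h0 : 0 ≤ blochRadius ρ := norm_nonneg _
  have h1 := hρ.blochRadius_le_one
  refine ⟨fun r hr => kappa_nonneg hr.1.le h0, ?_⟩
  obtain ⟨hR0, hR⟩ := volume_range_coords_ne_zero
  obtain ⟨C, hC⟩ := exists_map_blochVector_linOf_eq_smul hρ
  have hX : Measurable fun x => blochVector (linOf x ρ) :=
    (continuous_blochVector.comp (continuous_linOf_apply ρ)).measurable
  -- Measurability comes with the uniform law: the push-forward along a map that is not almost
  -- everywhere measurable would be zero.
  have hcoords : AEMeasurable (fun ω => (Φ ω).coords) P := pdf.IsUniform.aemeasurable hR0 hR hΦ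
  have hrad : (fun ω => blochRadius ((Φ ω).toLinearMap ρ)) =
      (fun v => ‖v‖) ∘ (fun x => blochVector (linOf x ρ)) ∘ fun ω => (Φ ω).coords := by
    ext ω
    simp [blochRadius, QubitChannel.linOf_coords]
  have hprob : IsProbabilityMeasure (P.map fun ω => blochRadius ((Φ ω).toLinearMap ρ)) :=
    Measure.isProbabilityMeasure_map (hrad ▸ measurable_norm.comp_aemeasurable
      (hX.comp_aemeasurable hcoords))
  have hlaw : P.map (fun ω => (Φ ω).coords) = (volume (Set.range QubitChannel.coords))⁻¹ •
      volume.restrict (Set.range QubitChannel.coords) := hΦ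
  have hmap : P.map (fun ω => blochRadius ((Φ ω).toLinearMap ρ)) =
      ((volume (Set.range QubitChannel.coords))⁻¹ * (C *
        (volume : Measure (EuclideanSpace ℝ (Fin 3))).toSphere Set.univ)) •
        (volume.restrict (Set.Ioc (0 : ℝ) 1)).withDensity
          (fun r => ENNReal.ofReal (kappa r (blochRadius ρ))) := by
    rw [hrad, ← AEMeasurable.map_map_of_aemeasurable measurable_norm.aemeasurable
        (hX.comp_aemeasurable hcoords),
      ← AEMeasurable.map_map_of_aemeasurable hX.aemeasurable hcoords, hlaw, Measure.map_smul, hC,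
      Measure.map_smul, Measure.map_smul, map_norm_blochMeasure, smul_smul, smul_smul,
      mul_assoc]
  -- Both measures have mass one, which forces the scalar in `hmap` to be `1`.
  have hmass := hprob.measure_univ
  rw [hmap, Measure.smul_apply, withDensity_kappa_univ h0 h1, smul_eq_mul, mul_one] at hmass
  rw [hmap, hmass, one_smul]
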